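/- Let $f:\mathbb{R}^n\to\mathbb{R}^n$ be of class $C^2$ and let the system $u_t+f(u)_x=0$ be strictly hyperbolic, i.e. for every $v\in\mathbb{R}^n$ the Jacobian matrix $Df(v)$ has $n$ real distinct eigenvalues. For every $M\ge 0$ there is a constant $C$, depending only on $f$ and $M$, such that the following holds. Let $u=u(t,x)$, $t\ge 0$, $x\in\mathbb{R}$, be a weak solution of $u_t+f(u)_x=0$ on $]0,\infty[\,\times\mathbb{R}$ (that is, $u$ and $f(u)$ are locally integrable on this set and $\iint \{u\,\phi_t+f(u)\,\phi_x\}\,dx\,dt=0$ for every $\phi\in C^1_c(]0,\infty[\,\times\mathbb{R})$), such that the map $t\mapsto u(t,\cdot)$ is Lipschitz continuous from $[0,\infty[$ into $L^1(\mathbb{R};\mathbb{R}^n)$, and such that all characteristic speeds, i.e. all eigenvalues of the matrices $Df(u(t,x))$, are contained in $[-1,1]$. Let $\tau\ge 0$, $-\infty\le a<b\le+\infty$ and $\varepsilon\ge 0$. Assume that (i) $\mathrm{Tot.Var.}\{u(t,\cdot)\}\le M$ for all $t\ge 0$; (ii) $\mathrm{Tot.Var.}\{u(\tau,\cdot);\,]a,b[\,\}\le\varepsilon$;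 (iii) setting $V(t)=\mathrm{Tot.Var.}\big\{u(t,\cdot);\,]a+(t-\tau),\,b-(t-\tau)[\,\big\}$, one has $$\lim_{h\to0+}\frac{\mathrm{meas}\{t\in[\tau,\tau+h]\,;\ V(t)>2\varepsilon\}}{h}=0.$$ Let $\xi\in\,]a,b[$ and let $W=W(t,x)$ be the weak solution, for $t\ge\tau$, with $t\mapsto W(t,\cdot)$ continuous with values in $L^1(\mathbb{R};\mathbb{R}^n)$, of the linear Cauchy problem with constant coefficients $$w_t+\widetilde A\,w_x=0,\qquad w(\tau,x)=u(\tau,x),\qquad \widetilde A=Df(u(\tau,\xi)).$$ Then $$\limsup_{h\to0+}\frac1h\int_{a+h}^{b-h}\big|u(\tau+h,x)-W(\tau+h,x)\big|\,dx\ \le\ C\,\varepsilon^2 .$$ -/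

import Mathlib

open MeasureTheory Filter Set
open scoped Topology ENNReal NNReal

namespace ConservationLaw

/-- The state space `ℝⁿ` with the Euclidean norm. -/
abbrev State (n : ℕ) : Type := EuclideanSpace ℝ (Fin n)

/-- The system `u_t + f(u)_x = 0` is strictly hyperbolic: at every state `v` the Jacobian matrix
`Df(v)` has `n` real distinct eigenvalues `λ₁(v) < ⋯ < λₙ(v)`. -/
def StrictlyHyperbolic {n : ℕ} (f : State n → State n) : Prop :=
  ∀ v : State n, ∃ lam : Fin n → ℝ, StrictMono lam ∧
    ∀ i, Module.End.HasEigenvalue (fderiv ℝ f v : State n →ₗ[ℝ] State n) (lam i)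

/-- All characteristic speeds at the state `v`, i.e. all eigenvalues of `Df(v)`, lie in
`[-1, 1]`. -/
def SpeedsInUnit {n : ℕ} (f : State n → State n) (v : State n) : Prop :=
  ∀ μ : ℝ, Module.End.HasEigenvalue (fderiv ℝ f v : State n →ₗ[ℝ] State n) μ →
    μ ∈ Icc (-1 : ℝ) 1

/-- `u = u(t,x)` is a weak solution of `u_t + f(u)_x = 0` on the open set `Ω` of the `(t,x)`-plane:
`u` and `f(u)` are in `L¹_loc(Ω)`, and `∬ (u φ_t + f(u) φ_x) dx dt = 0` for every scalar test
function `φ` of class `C¹` with compact support in `Ω`. -/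
structure IsWeakSolution {n : ℕ} (f : State n → State n) (Ω : Set (ℝ × ℝ))
    (u : ℝ → ℝ → State n) : Prop where
  locallyIntegrable : LocallyIntegrableOn (fun p : ℝ × ℝ => u p.1 p.2) Ω volume
  locallyIntegrable_flux : LocallyIntegrableOn (fun p : ℝ × ℝ => f (u p.1 p.2)) Ω volume
  integral_eq_zero : ∀ φ : ℝ × ℝ → ℝ, ContDiff ℝ 1 φ → HasCompactSupport φ → tsupport φ ⊆ Ω →
    ∫ p in Ω, (fderiv ℝ φ p (1, 0) • u p.1 p.2 + fderiv ℝ φ p (0, 1) • f (u p.1 p.2)) = 0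

/-- The map `t ↦ u(t,·)`, `t ≥ 0`, is Lipschitz continuous with values in `L¹(ℝ; ℝⁿ)`. -/
def LipschitzInL1 {n : ℕ} (u : ℝ → ℝ → State n) : Prop :=
  (∀ t, 0 ≤ t → Integrable (u t) volume) ∧
    ∃ L : ℝ, ∀ s t, 0 ≤ s → 0 ≤ t → ∫ x, ‖u t x - u s x‖ ≤ L * |t - s|

/-- `w` is a weak solution, for times `t ≥ τ`, of the Cauchy problem `w_t + f(w)_x = 0`,
`w(τ,·) = w₀`: the map `t ↦ w(t,·)` is continuous with values in `L¹(ℝ; ℝⁿ)`, the initial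
condition holds, and the equation holds in the distributional sense on `]τ,∞[ × ℝ`. -/
structure IsWeakCauchySolution {n : ℕ} (f : State n → State n) (τ : ℝ) (w₀ : ℝ → State n)
    (w : ℝ → ℝ → State n) : Prop where
  integrable : ∀ t, τ ≤ t → Integrable (w t) volume
  continuous : ∀ t, τ ≤ t →
    Tendsto (fun s => ∫ x, ‖w s x - w t x‖) (𝓝[Ici τ] t) (𝓝 0)
  initial : w τ =ᵐ[volume] w₀
  weak : IsWeakSolution f (Ioi τ ×ˢ univ) w

/-- The open interval `]a + h, b - h[` of the real line; the endpoints `a = -∞` and `b = +∞` are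
allowed. -/
def shrink (a b : EReal) (h : ℝ) : Set ℝ :=
  {x : ℝ | a + (h : EReal) < (x : EReal) ∧ (x : EReal) < b - (h : EReal)}

/-- `V(t) = Tot.Var.{u(t,·); ]a + (t - τ), b - (t - τ)[}`. -/
noncomputable def V {n : ℕ} (u : ℝ → ℝ → State n) (τ : ℝ) (a b : EReal) (t : ℝ) : ℝ≥0∞ :=
  eVariationOn (u t) (shrink a b (t - τ))

end ConservationLaw

namespace ConservationLaw

/-! ### Uniform bounds for the spectral projections -/

section Spectral

variable {E : Type*} [NormedAddCommGroup E] [NormedSpace ℝ E]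

/-! Let v₀ = u(τ,ξ), A = Df(v₀) and f(v) = f(0) + Av + g(v). If a functional l satisfies l∘A = λl,
then l(u − W) solves z_t + λz_x = −(l g(u))_x with zero initial data. Testing with a function
constant along lines of speed λ (`integral_mul_sub_eq`) writes ∫ψ l(u − W) at time τ+h as the
integral over r in [τ, τ+h] of a translate of ψ′ paired with l(g(u(r,·))). Since |λ| ≤ 1, the
translate is supported in the interval that defines V(r), so by `abs_integral_deriv_mul_le` the
pairing is at most the variation of l(g(u(r,·))) there.

The derivative of g vanishes at v₀, so g has Lipschitz constant KR on states within R of v₀. If V(r)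
≤ 2ε and r is close to τ, then R = 3ε + δ is allowed (`eventually_norm_sub_le`) and the variation is
O(ε²). The other times contribute a bounded amount each and have measure o(h). Duality with test
functions (`setLIntegral_enorm_le_of_forall_test`) turns this into an L¹ bound O(ε²)h + o(h) for
each l, which is `eventually_setLIntegral_enorm_le`.

The functionals l are the coordinates of the spectral projections of A, which sum to the identity.
For C to depend only on f and M, their norms must be bounded uniformly over ‖v₀‖ ≤ M; strict
hyperbolicity and compactness give this in `exists_spectral_bound`. -/

theorem aeval_apply_of_eq_smul {A : E →L[ℝ] E} {r : E} {μ : ℝ} (h : A r = μ • r)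
    (p : Polynomial ℝ) : Polynomial.aeval A p r = p.eval μ • r := by
  have key : ∀ k : ℕ, (A ^ k) r = μ ^ k • r := by
    intro k
    induction k with
    | zero => simp
    | succ k ih => rw [pow_succ', mul_apply_eq_comp, ih, map_smul, h, smul_smul, pow_succ]
  induction p using Polynomial.induction_on' with
  | add p q hp hq => simp [hp, hq, add_smul]
  | monomial k c =>
    rw [Polynomial.aeval_monomial, Polynomial.eval_monomial, mul_apply_eq_comp, key,
      Algebra.algebraMap_eq_smul_one, mul_smul]
    rfl

theorem continuousOn_aeval_prod {X ι : Type*} [TopologicalSpace X] {S : Set X}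
    (A : X → E →L[ℝ] E) (p : ι → X → Polynomial ℝ) (s : Finset ι)
    (h : ∀ j ∈ s, ContinuousOn (fun x => Polynomial.aeval (A x) (p j x)) S) :
    ContinuousOn (fun x => Polynomial.aeval (A x) (∏ j ∈ s, p j x)) S := by
  classical
  induction s using Finset.induction_on with
  | empty => simpa using continuousOn_const
  | insert j s hj ih =>
    simp only [Finset.prod_insert hj, map_mul]
    exact (h j (by simp)).mul (ih fun k hk => h k (by simp [hk]))

theorem continuousOn_aeval_linear {X : Type*} [TopologicalSpace X] {S : Set X}
    {A : X → E →L[ℝ] E} {c l : X → ℝ} (hA : ContinuousOn A S) (hc : ContinuousOn c S)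
    (hl : ContinuousOn l S) :
    ContinuousOn (fun x => Polynomial.aeval (A x)
      (Polynomial.C (c x) * (Polynomial.X - Polynomial.C (l x)))) S := by
  simp only [map_mul, map_sub, Polynomial.aeval_X, Polynomial.aeval_C,
    Algebra.algebraMap_eq_smul_one]
  exact (hc.smul continuousOn_const).mul (hA.sub (hl.smul continuousOn_const))

theorem continuousOn_aeval_nodal {X ι : Type*} [Fintype ι] [TopologicalSpace X] {S : Set X}
    {A : X → E →L[ℝ] E} {l : X → ι → ℝ} (hA : ContinuousOn A S)
    (hl : ∀ j, ContinuousOn (fun x => l x j) S) :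
    ContinuousOn (fun x => Polynomial.aeval (A x) (Lagrange.nodal Finset.univ (l x))) S := by
  simp only [Lagrange.nodal_eq]
  refine continuousOn_aeval_prod A (fun j x => Polynomial.X - Polynomial.C (l x j)) _ fun j _ => ?_
  simpa only [Polynomial.C_1, one_mul] using
    continuousOn_aeval_linear hA (continuousOn_const (c := (1 : ℝ))) (hl j)

/-- Distinct nodes keep the denominators of the Lagrange polynomials away from zero. -/
theorem continuousOn_aeval_basis {X ι : Type*} [Fintype ι] [DecidableEq ι] [TopologicalSpace X]
    {S : Set X} {A : X → E →L[ℝ] E} {l : X → ι → ℝ} (hA : ContinuousOn A S)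
    (hl : ∀ j, ContinuousOn (fun x => l x j) S) (hinj : ∀ x ∈ S, Function.Injective (l x)) (i : ι) :
    ContinuousOn (fun x => Polynomial.aeval (A x) (Lagrange.basis Finset.univ (l x) i)) S := by
  simp only [Lagrange.basis]
  refine continuousOn_aeval_prod A (fun j x => Lagrange.basisDivisor (l x i) (l x j)) _
    fun j hj => ?_
  refine continuousOn_aeval_linear hA (ContinuousOn.inv₀ ((hl i).sub (hl j)) ?_) (hl j)
  intro x hx h
  exact (Finset.ne_of_mem_erase hj) (hinj x hx (sub_eq_zero.1 h)).symm

/-- If `A` has `n = dim E` distinct eigenvalues, every family of `n` numbers that annihilates `A`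
consists of distinct numbers. -/
theorem injective_of_aeval_nodal_eq_zero {n : ℕ} {A : E →L[ℝ] E} {mu lam : Fin n → ℝ}
    (hmu : Function.Injective mu)
    (hev : ∀ i, Module.End.HasEigenvalue (A : E →ₗ[ℝ] E) (mu i))
    (h0 : Polynomial.aeval A (Lagrange.nodal Finset.univ lam) = 0) :
    Function.Injective lam := by
  -- Applied to an eigenvector, the annihilating polynomial must vanish at the eigenvalue. The
  -- resulting matching of indices is injective, hence bijective on `Fin n`.
  have hmem : ∀ i, ∃ j, lam j = mu i := by
    intro i
    obtain ⟨r, hr⟩ := (hev i).exists_hasEigenvector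
    have h1 : A r = mu i • r := hr.apply_eq_smul
    have h2 := aeval_apply_of_eq_smul h1 (Lagrange.nodal Finset.univ lam)
    rw [h0, zero_apply, Lagrange.eval_nodal] at h2
    rcases smul_eq_zero.1 h2.symm with h3 | h3
    · obtain ⟨j, -, hj⟩ := Finset.prod_eq_zero_iff.1 h3
      exact ⟨j, by linarith⟩
    · exact absurd h3 hr.2
  choose σ hσ using hmem
  have hσi : Function.Injective σ := fun i j hij => hmu (by rw [← hσ i, ← hσ j, hij])
  have hσs : Function.Surjective σ := Finite.surjective_of_injective hσi
  intro i j hij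
  obtain ⟨i', rfl⟩ := hσs i
  obtain ⟨j', rfl⟩ := hσs j
  rw [hσ, hσ] at hij
  rw [hmu hij]

/-- Eigenvectors for distinct eigenvalues form a basis, and the polynomial kills each of them. -/
theorem aeval_nodal_eq_zero {n : ℕ} [FiniteDimensional ℝ E] (hn : Module.finrank ℝ E = n)
    {A : E →L[ℝ] E} {mu : Fin n → ℝ} (hmu : Function.Injective mu)
    (hev : ∀ i, Module.End.HasEigenvalue (A : E →ₗ[ℝ] E) (mu i)) :
    Polynomial.aeval A (Lagrange.nodal Finset.univ mu) = 0 := by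
  choose r hr using fun i => (hev i).exists_hasEigenvector
  have hli : LinearIndependent ℝ r :=
    Module.End.eigenvectors_linearIndependent' (A : E →ₗ[ℝ] E) mu hmu r hr
  have hsp := hli.span_eq_top_of_card_eq_finrank' (by simp [hn])
  have : ((Polynomial.aeval A (Lagrange.nodal Finset.univ mu) : E →L[ℝ] E) : E →ₗ[ℝ] E) = 0 := by
    refine LinearMap.ext_on_range hsp fun i => ?_
    have h1 : A (r i) = mu i • r i := (hr i).apply_eq_smul
    simp [aeval_apply_of_eq_smul h1, Lagrange.eval_nodal_at_node (Finset.mem_univ i)]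
  exact ContinuousLinearMap.coe_injective this

/-- The Lagrange polynomial times `X - lam i` is a multiple of the nodal polynomial. Composing a
functional with the spectral projection therefore gives a left eigenvector of `A`. -/
theorem aeval_basis_mul {n : ℕ} {A : E →L[ℝ] E} {lam : Fin n → ℝ}
    (h0 : Polynomial.aeval A (Lagrange.nodal Finset.univ lam) = 0) (i : Fin n) :
    (Polynomial.aeval A (Lagrange.basis Finset.univ lam i)).comp A =
      lam i • Polynomial.aeval A (Lagrange.basis Finset.univ lam i) := by
  have h1 : Lagrange.basis Finset.univ lam i * (Polynomial.X - Polynomial.C (lam i)) =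
      (∏ j ∈ Finset.univ.erase i, Polynomial.C (lam i - lam j)⁻¹) *
        Lagrange.nodal Finset.univ lam := by
    rw [Lagrange.basis, Lagrange.nodal_eq_mul_nodal_erase (Finset.mem_univ i), Lagrange.nodal]
    simp only [Lagrange.basisDivisor, Finset.prod_mul_distrib]
    ring
  have h2 := congrArg (Polynomial.aeval A) h1
  rw [map_mul, map_mul, h0, mul_zero, map_sub, mul_sub, Polynomial.aeval_X, Polynomial.aeval_C,
    sub_eq_zero] at h2
  change Polynomial.aeval A (Lagrange.basis Finset.univ lam i) * A = _
  rw [h2, Algebra.algebraMap_eq_smul_one, mul_smul_comm, mul_one]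

end Spectral

/-- The projections are Lagrange polynomials in Df(v). Continuity of the eigenvalues in v is
bypassed: the pairs (v, lam) with v in the ball, lam bounded and the nodal polynomial of lam
annihilating Df(v) form a compact set, on which lam has distinct entries and the projections are
continuous. -/
theorem exists_spectral_bound {n : ℕ} {f : State n → State n} (hf : ContDiff ℝ 2 f)
    (hyp : StrictlyHyperbolic f) (M : ℝ) :
    ∃ Γ : ℝ, ∀ v, ‖v‖ ≤ M → ∃ (lam : Fin n → ℝ) (P : Fin n → State n →L[ℝ] State n),
      (∀ i, Module.End.HasEigenvalue (fderiv ℝ f v : State n →ₗ[ℝ] State n) (lam i)) ∧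
      (∀ i, (P i).comp (fderiv ℝ f v) = lam i • P i) ∧
      (∑ i, P i = ContinuousLinearMap.id ℝ (State n)) ∧ ∀ i, ‖P i‖ ≤ Γ := by
  have hDf : Continuous (fderiv ℝ f) := hf.continuous_fderiv (by norm_num)
  obtain ⟨R, hR⟩ := (isCompact_closedBall (0 : State n) M).exists_bound_of_continuousOn
    hDf.continuousOn
  let S : Set (State n × (Fin n → ℝ)) := {p | p ∈ Metric.closedBall (0 : State n) M ×ˢ
    Metric.closedBall (0 : Fin n → ℝ) R ∧
    Polynomial.aeval (fderiv ℝ f p.1) (Lagrange.nodal Finset.univ p.2) = 0}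
  have hcA : ∀ T : Set (State n × (Fin n → ℝ)), ContinuousOn (fun p => fderiv ℝ f p.1) T :=
    fun T => (hDf.comp continuous_fst).continuousOn
  have hcl : ∀ (T : Set (State n × (Fin n → ℝ))) (j : Fin n), ContinuousOn (fun p => p.2 j) T :=
    fun T j => ((continuous_apply j).comp continuous_snd).continuousOn
  have hSc : IsCompact S := by
    have hclosed : IsClosed {p : State n × (Fin n → ℝ) |
        Polynomial.aeval (fderiv ℝ f p.1) (Lagrange.nodal Finset.univ p.2) = 0} :=
      isClosed_eq (continuousOn_univ.1 (continuousOn_aeval_nodal (hcA univ) (hcl univ)))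
        continuous_const
    exact ((isCompact_closedBall _ _).prod (isCompact_closedBall _ _)).inter_right hclosed
  have hinj : ∀ p ∈ S, Function.Injective p.2 := by
    intro p hp
    obtain ⟨mu, hmu, hev⟩ := hyp p.1
    exact injective_of_aeval_nodal_eq_zero hmu.injective hev hp.2
  have hcont : ∀ i, ContinuousOn (fun p : State n × (Fin n → ℝ) =>
      Polynomial.aeval (fderiv ℝ f p.1) (Lagrange.basis Finset.univ p.2 i)) S :=
    continuousOn_aeval_basis (hcA S) (hcl S) hinj
  choose Γ hΓ using fun i => hSc.exists_bound_of_continuousOn (hcont i)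
  refine ⟨∑ i, |Γ i|, fun v hv => ?_⟩
  obtain ⟨lam, hlam, hev⟩ := hyp v
  have h0 := aeval_nodal_eq_zero (by simp) hlam.injective hev
  have hvR := hR v (by simpa using hv)
  have hmemS : (v, lam) ∈ S := by
    refine ⟨⟨by simpa using hv, ?_⟩, h0⟩
    -- Each eigenvalue is bounded by the operator norm of Df(v), hence by `R`.
    rw [mem_closedBall_zero_iff, pi_norm_le_iff_of_nonneg ((norm_nonneg _).trans hvR)]
    intro i
    obtain ⟨r, hr⟩ := (hev i).exists_hasEigenvector
    have h1 : fderiv ℝ f v r = lam i • r := hr.apply_eq_smul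
    have h2 := (fderiv ℝ f v).le_of_opNorm_le hvR r
    rw [h1, norm_smul] at h2
    exact le_of_mul_le_mul_right h2 (norm_pos_iff.2 hr.2)
  refine ⟨lam, fun i => Polynomial.aeval (fderiv ℝ f v) (Lagrange.basis Finset.univ lam i), hev,
    aeval_basis_mul h0, ?_, fun i => ?_⟩
  · rcases Finset.univ.eq_empty_or_nonempty (α := Fin n) with he | hne
    · have : n = 0 := by simpa using congrArg Finset.card he
      subst this
      ext x i
      exact i.elim0
    · rw [← map_sum, Lagrange.sum_basis hlam.injective.injOn hne, map_one]
      rfl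
  · exact (hΓ i _ hmemS).trans ((le_abs_self _).trans
      (Finset.single_le_sum (f := fun i => |Γ i|) (fun _ _ => abs_nonneg _) (Finset.mem_univ i)))

/-! ### Weak derivatives of continuous functions of one variable -/

theorem support_deriv_smoothTransition :
    Function.support (deriv Real.smoothTransition) ⊆ Ioc (0 : ℝ) 1 := by
  intro y hy
  rw [Function.mem_support] at hy
  constructor
  · by_contra! h
    refine hy (IsLocalMin.deriv_eq_zero (Eventually.of_forall fun x => ?_))
    rw [Real.smoothTransition.zero_of_nonpos h]
    exact Real.smoothTransition.nonneg x
  · by_contra! h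
    refine hy (IsLocalMax.deriv_eq_zero (Eventually.of_forall fun x => ?_))
    rw [Real.smoothTransition.one_of_one_le h.le]
    exact Real.smoothTransition.le_one x

theorem continuous_deriv_smoothTransition : Continuous (deriv Real.smoothTransition) :=
  (Real.smoothTransition.contDiff (n := 1)).continuous_deriv (by norm_num)

theorem differentiable_smoothTransition : Differentiable ℝ Real.smoothTransition :=
  (Real.smoothTransition.contDiff (n := 1)).differentiable (by norm_num)

theorem integral_scaled_deriv_smoothTransition_mul (H : ℝ → ℝ) (s : ℝ) {δ : ℝ} (hδ : 0 < δ) :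
    ∫ r, deriv Real.smoothTransition ((r - s) / δ) / δ * H r =
      ∫ y in (0 : ℝ)..1, deriv Real.smoothTransition y * H (s + δ * y) := by
  have h1 : ∫ y, (fun r => deriv Real.smoothTransition ((r - s) / δ) / δ * H r) (s + δ * y) =
      δ⁻¹ * ∫ r, deriv Real.smoothTransition ((r - s) / δ) / δ * H r := by
    rw [Measure.integral_comp_mul_left
      (fun r => (fun r => deriv Real.smoothTransition ((r - s) / δ) / δ * H r) (s + r)) δ,
      integral_add_left_eq_self
        (fun r => deriv Real.smoothTransition ((r - s) / δ) / δ * H r) s,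
      abs_of_pos (inv_pos.2 hδ), smul_eq_mul]
  have h2 : ∀ y, (fun r => deriv Real.smoothTransition ((r - s) / δ) / δ * H r) (s + δ * y) =
      δ⁻¹ * (deriv Real.smoothTransition y * H (s + δ * y)) := by
    intro y
    have : (s + δ * y - s) / δ = y := by field_simp; ring
    simp only [this]
    ring
  simp only [h2] at h1
  rw [integral_const_mul] at h1
  rw [← mul_left_cancel₀ (inv_pos.2 hδ).ne' h1]
  refine (intervalIntegral.integral_eq_integral_of_support_subset ?_).symm
  exact (Function.support_mul_subset_left _ _).trans support_deriv_smoothTransition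

theorem integral_deriv_smoothTransition :
    ∫ y in (0 : ℝ)..1, deriv Real.smoothTransition y = 1 := by
  rw [intervalIntegral.integral_deriv_eq_sub (fun x _ => differentiable_smoothTransition x)
    (continuous_deriv_smoothTransition.intervalIntegrable _ _)]
  simp

/-- Take for χ the difference of two smooth steps, rising on [s, s+δ] and [t, t+δ]. The hypothesis
equates the weighted means of H over these intervals; then δ → 0. -/
theorem eq_of_integral_deriv_mul_eq_zero {H : ℝ → ℝ} {T₀ : ℝ} (hH : Continuous H)
    (h : ∀ χ : ℝ → ℝ, ContDiff ℝ 1 χ → HasCompactSupport χ → tsupport χ ⊆ Ioi T₀ →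
      ∫ r, deriv χ r * H r = 0) {s t : ℝ} (hs : T₀ < s) (hst : s ≤ t) : H s = H t := by
  let J : ℝ → ℝ → ℝ := fun a δ => ∫ y in (0 : ℝ)..1, deriv Real.smoothTransition y * H (a + δ * y)
  have hJ : ∀ a, Continuous (J a) := fun a =>
    intervalIntegral.continuous_parametric_intervalIntegral_of_continuous'
      (by
        refine (continuous_deriv_smoothTransition.comp continuous_snd).mul (hH.comp ?_)
        fun_prop) 0 1
  have hJ0 : ∀ a, J a 0 = H a := by
    intro a
    simp only [J, zero_mul, add_zero]
    rw [intervalIntegral.integral_mul_const, integral_deriv_smoothTransition, one_mul]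
  have hJe : ∀ δ : ℝ, 0 < δ → J s δ = J t δ := by
    intro δ hδ
    let χ : ℝ → ℝ := fun r =>
      Real.smoothTransition ((r - s) / δ) - Real.smoothTransition ((r - t) / δ)
    have hχ : ContDiff ℝ 1 χ := by
      refine (Real.smoothTransition.contDiff.comp ?_).sub (Real.smoothTransition.contDiff.comp ?_)
      · exact (contDiff_id.sub contDiff_const).div_const δ
      · exact (contDiff_id.sub contDiff_const).div_const δ
    have hsupp : tsupport χ ⊆ Icc s (t + δ) := by
      refine closure_minimal (fun r hr => ?_) isClosed_Icc
      rw [Function.mem_support] at hr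
      by_contra hr'
      rw [mem_Icc, not_and_or, not_le, not_le] at hr'
      refine hr ?_
      rcases hr' with h1 | h1
      · simp only [χ]
        rw [Real.smoothTransition.zero_of_nonpos, Real.smoothTransition.zero_of_nonpos, sub_zero]
        · exact div_nonpos_of_nonpos_of_nonneg (by linarith) hδ.le
        · exact div_nonpos_of_nonpos_of_nonneg (by linarith) hδ.le
      · simp only [χ]
        rw [Real.smoothTransition.one_of_one_le, Real.smoothTransition.one_of_one_le, sub_self]
        · rw [one_le_div hδ]; linarith
        · rw [one_le_div hδ]; linarith
    have hd : ∀ r, deriv χ r = deriv Real.smoothTransition ((r - s) / δ) / δ -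
        deriv Real.smoothTransition ((r - t) / δ) / δ := by
      intro r
      have key : ∀ a, HasDerivAt (fun r => Real.smoothTransition ((r - a) / δ))
          (deriv Real.smoothTransition ((r - a) / δ) / δ) r := by
        intro a
        have h1 := (differentiable_smoothTransition ((r - a) / δ)).hasDerivAt
        have h2 : HasDerivAt (fun r => (r - a) / δ) (1 / δ) r :=
          ((hasDerivAt_id r).sub_const a).div_const δ
        have h3 := h1.comp r h2
        rw [mul_one_div] at h3
        exact h3
      exact ((key s).sub (key t)).deriv
    have hint : ∀ a, Integrable fun r => deriv Real.smoothTransition ((r - a) / δ) / δ * H r := by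
      intro a
      refine Continuous.integrable_of_hasCompactSupport ?_ ?_
      · refine ((continuous_deriv_smoothTransition.comp ?_).div_const δ).mul hH
        fun_prop
      · refine HasCompactSupport.of_support_subset_isCompact (isCompact_Icc (a := a) (b := a + δ))
          fun r hr => ?_
        have h1 : deriv Real.smoothTransition ((r - a) / δ) ≠ 0 := by
          intro h0
          simp [h0] at hr
        have h2 := support_deriv_smoothTransition h1
        rw [mem_Ioc, div_le_one hδ] at h2
        have h3 : 0 < r - a := by
          by_contra! h4
          exact absurd h2.1 (not_lt.2 (div_nonpos_of_nonpos_of_nonneg h4 hδ.le))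
        exact ⟨by linarith, by linarith⟩
    have h0 := h χ hχ (HasCompactSupport.of_support_subset_isCompact isCompact_Icc
      ((subset_tsupport _).trans hsupp)) (hsupp.trans fun r hr => hs.trans_le hr.1)
    simp only [hd, sub_mul] at h0
    rw [integral_sub (hint s) (hint t), integral_scaled_deriv_smoothTransition_mul H s hδ,
      integral_scaled_deriv_smoothTransition_mul H t hδ, sub_eq_zero] at h0
    exact h0
  have hlim : ∀ a, Tendsto (J a) (𝓝[>] 0) (𝓝 (H a)) := fun a => by
    rw [← hJ0 a]
    exact ((hJ a).tendsto 0).mono_left nhdsWithin_le_nhds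
  refine tendsto_nhds_unique ((hlim s).congr' ?_) (hlim t)
  filter_upwards [self_mem_nhdsWithin] with δ hδ using hJe δ hδ

/-- A continuous function on `[T₀, ∞[` whose distributional derivative is continuous is a primitive
of that derivative. -/
theorem sub_eq_integral_of_weak_deriv {F G : ℝ → ℝ} {T₀ : ℝ} (hF : ContinuousOn F (Ici T₀))
    (hG : ContinuousOn G (Ici T₀))
    (h : ∀ χ : ℝ → ℝ, ContDiff ℝ 1 χ → HasCompactSupport χ → tsupport χ ⊆ Ioi T₀ →
      ∫ r in Ioi T₀, (deriv χ r * F r + χ r * G r) = 0) {t : ℝ} (ht : T₀ ≤ t) :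
    F t - F T₀ = ∫ r in T₀..t, G r := by
  -- Constant extension to the left of T₀ gives functions continuous on the whole line, unchanged on
  -- the supports of the test functions.
  let F' : ℝ → ℝ := fun r => F (max T₀ r)
  let G' : ℝ → ℝ := fun r => G (max T₀ r)
  have hmax : Continuous fun r : ℝ => max T₀ r := by fun_prop
  have hF' : Continuous F' := hF.comp_continuous hmax fun r => mem_Ici.2 (le_max_left _ _)
  have hG' : Continuous G' := hG.comp_continuous hmax fun r => mem_Ici.2 (le_max_left _ _)
  let P : ℝ → ℝ := fun r => ∫ x in T₀..r, G' x
  have hP : ∀ r, HasDerivAt P (G' r) r := fun r =>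
    intervalIntegral.integral_hasDerivAt_right (hG'.intervalIntegrable _ _)
      (hG'.stronglyMeasurableAtFilter _ _) hG'.continuousAt
  have hPc : Continuous P := continuous_iff_continuousAt.2 fun r => (hP r).continuousAt
  have hH : Continuous fun r => F' r - P r := hF'.sub hPc
  have key : ∀ χ : ℝ → ℝ, ContDiff ℝ 1 χ → HasCompactSupport χ → tsupport χ ⊆ Ioi T₀ →
      ∫ r, deriv χ r * (F' r - P r) = 0 := by
    intro χ hχ hc hs
    have hd : Continuous (deriv χ) := hχ.continuous_deriv (by norm_num)
    have i1 : Integrable fun r => deriv χ r * F' r :=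
      (hd.mul hF').integrable_of_hasCompactSupport hc.deriv.mul_right
    have i2 : Integrable fun r => P r * deriv χ r :=
      (hPc.mul hd).integrable_of_hasCompactSupport hc.deriv.mul_left
    have i3 : Integrable fun r => G' r * χ r :=
      (hG'.mul hχ.continuous).integrable_of_hasCompactSupport hc.mul_left
    have i4 : Integrable fun r => P r * χ r :=
      (hPc.mul hχ.continuous).integrable_of_hasCompactSupport hc.mul_left
    have h1 : ∫ r, P r * deriv χ r = - ∫ r, G' r * χ r :=
      integral_mul_deriv_eq_deriv_mul_of_integrable (fun x _ => hP x)
        (fun x _ => ((hχ.differentiable (by norm_num)) x).hasDerivAt) i2 i3 i4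
    have h2 := h χ hχ hc hs
    have h3 : ∫ r in Ioi T₀, (deriv χ r * F r + χ r * G r) =
        ∫ r, (deriv χ r * F' r + G' r * χ r) := by
      rw [← setIntegral_eq_integral_of_forall_compl_eq_zero (μ := volume) (s := Ioi T₀)
        (f := fun r => deriv χ r * F' r + G' r * χ r)]
      · refine setIntegral_congr_fun measurableSet_Ioi fun r hr => ?_
        simp only [F', G', max_eq_right (le_of_lt (mem_Ioi.1 hr))]
        ring
      · intro r hr
        have h4 : r ∉ tsupport χ := fun h5 => hr (hs h5)
        have h5 : χ r = 0 := image_eq_zero_of_notMem_tsupport h4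
        have h6 : deriv χ r = 0 := by
          by_contra h7
          exact h4 (support_deriv_subset h7)
        simp [h5, h6]
    rw [h3, integral_add i1 i3] at h2
    simp only [mul_sub]
    rw [integral_sub i1 (by simpa only [mul_comm] using i2)]
    simp only [mul_comm (deriv χ _) (P _)]
    linarith
  -- Constancy is known only on the open half-line; continuity carries it to T₀.
  have heq : F' T₀ - P T₀ = F' t - P t := by
    rcases ht.eq_or_lt with rfl | ht'
    · rfl
    have hlim : Tendsto (fun r => F' r - P r) (𝓝[>] T₀) (𝓝 (F' T₀ - P T₀)) :=
      (hH.tendsto T₀).mono_left nhdsWithin_le_nhds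
    refine tendsto_nhds_unique hlim (tendsto_const_nhds.congr' ?_)
    filter_upwards [Ioc_mem_nhdsGT ht'] with r hr
    exact (eq_of_integral_deriv_mul_eq_zero hH key hr.1 hr.2).symm
  have hPt : P t = ∫ r in T₀..t, G r := by
    refine intervalIntegral.integral_congr fun r hr => ?_
    rw [uIcc_of_le ht] at hr
    simp only [G', max_eq_right hr.1]
  simp only [F', max_self, max_eq_right ht, P, intervalIntegral.integral_same] at heq
  rw [← hPt]
  simp only [P]
  linarith

/-! ### Functions of bounded variation tested against derivatives -/

/-- The integral is, up to sign, the derivative at δ = 0 of δ ↦ ∫ψ(x − δ)q(x)dx. Moving the shift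
onto q bounds the increment by ∫(v(x+δ) − v(x))dx over [c,d], where v is the variation of q from c.
As v is monotone with values in [0,B] on [c,d+δ], this is at most Bδ. -/
theorem abs_integral_deriv_mul_le {q ψ : ℝ → ℝ} {I : Set ℝ} {B : ℝ} (hB0 : 0 ≤ B) (hI : IsOpen I)
    (hIc : I.OrdConnected) (hq : Integrable q) (hB : eVariationOn q I ≤ ENNReal.ofReal B)
    (hψ : ContDiff ℝ 1 ψ) (hc : HasCompactSupport ψ) (hs : tsupport ψ ⊆ I)
    (h1 : ∀ x, |ψ x| ≤ 1) : |∫ x, deriv ψ x * q x| ≤ B := by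
  rcases (tsupport ψ).eq_empty_or_nonempty with he | hne
  · have : ψ = 0 := tsupport_eq_empty_iff.1 he
    simpa [this] using hB0
  have hK : IsCompact (tsupport ψ) := hc
  set c := sInf (tsupport ψ)
  set d := sSup (tsupport ψ)
  have hcI : c ∈ I := hs (hK.sInf_mem hne)
  have hdI : d ∈ I := hs (hK.sSup_mem hne)
  have hKcd : tsupport ψ ⊆ Icc c d := fun x hx =>
    ⟨csInf_le hK.bddBelow hx, le_csSup hK.bddAbove hx⟩
  have hcd : c ≤ d := (hKcd hne.some_mem).1.trans (hKcd hne.some_mem).2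
  have hψ0 : ∀ x, x ∉ Icc c d → ψ x = 0 := fun x hx =>
    image_eq_zero_of_notMem_tsupport fun h => hx (hKcd h)
  have hbv : BoundedVariationOn q I := ne_top_of_le_ne_top ENNReal.ofReal_ne_top hB
  have hlbv := hbv.locallyBoundedVariationOn
  set v : ℝ → ℝ := variationOnFromTo q I c
  have hvm : MonotoneOn v I := variationOnFromTo.monotoneOn hlbv hcI
  have hvB : ∀ x, v x ≤ B := fun x => by
    have h2 : |v x| ≤ (eVariationOn q I).toReal := variationOnFromTo.abs_le_eVariationOn hbv
    exact (le_abs_self _).trans (h2.trans (ENNReal.toReal_le_of_le_ofReal hB0 hB))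
  have hvc : v c = 0 := variationOnFromTo.self q I c
  have hψb : ∀ x, ‖ψ x‖ ≤ 1 := h1
  have hint : ∀ δ, Integrable fun x => ψ (x - δ) * q x := fun δ =>
    hq.bdd_mul (c := 1) (hψ.continuous.comp (by fun_prop)).aestronglyMeasurable
      (Eventually.of_forall fun x => hψb _)
  have hdiff : ∀ δ, 0 < δ → d + δ ∈ I →
      |(∫ x, ψ (x - δ) * q x) - ∫ x, ψ (x - 0) * q x| ≤ B * δ := by
    intro δ hδ hdδ
    have hsub : Icc c (d + δ) ⊆ I := hIc.out hcI hdδ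
    have hii : ∀ a b, c ≤ a → a ≤ b → b ≤ d + δ → IntervalIntegrable v volume a b := by
      intro a b h2 h3 h4
      refine (hvm.mono ?_).intervalIntegrable
      rw [uIcc_of_le h3]
      exact (Icc_subset_Icc h2 h4).trans hsub
    have hsh : ∫ x, ψ (x - δ) * q x = ∫ x, ψ x * q (x + δ) := by
      rw [← integral_add_right_eq_self (fun x => ψ (x - δ) * q x) δ]
      simp
    have hint' : Integrable fun x => ψ x * q (x + δ) := by
      have := (hint δ).comp_add_right δ
      simpa using this
    have hint0 : Integrable fun x => ψ x * q x := by simpa using hint 0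
    simp only [sub_zero]
    rw [hsh, ← integral_sub hint' hint0]
    have hle : ∀ x, ‖ψ x * q (x + δ) - ψ x * q x‖ ≤
        (Icc c d).indicator (fun x => v (x + δ) - v x) x := by
      intro x
      by_cases hx : x ∈ Icc c d
      · rw [indicator_of_mem hx, ← mul_sub, norm_mul]
        have hxI : x ∈ I := hsub ⟨hx.1, hx.2.trans (by linarith)⟩
        have hxI' : x + δ ∈ I := hsub ⟨by linarith [hx.1], by linarith [hx.2]⟩
        have h3 : |q (x + δ) - q x| ≤ v (x + δ) - v x :=
          variationOnFromTo.abs_sub_le_sub_of_le hlbv hcI hxI hxI' (by linarith)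
        calc ‖ψ x‖ * ‖q (x + δ) - q x‖ ≤ 1 * ‖q (x + δ) - q x‖ := by
              gcongr; exact hψb x
          _ ≤ _ := by rw [one_mul]; exact h3
      · rw [indicator_of_notMem hx, hψ0 x hx]
        simp
    have hvi : IntervalIntegrable (fun x => v (x + δ)) volume c d := by
      have := (hii (c + δ) (d + δ) (by linarith) (by linarith) le_rfl).comp_add_right δ
      simpa using this
    have hvi' : IntervalIntegrable v volume c d := hii c d le_rfl hcd (by linarith)
    have hindi : Integrable ((Icc c d).indicator fun x => v (x + δ) - v x) := by
      rw [integrable_indicator_iff measurableSet_Icc, ← intervalIntegrable_iff_integrableOn_Icc_of_le hcd]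
      exact hvi.sub hvi'
    calc |∫ x, (ψ x * q (x + δ) - ψ x * q x)|
        ≤ ∫ x, (Icc c d).indicator (fun x => v (x + δ) - v x) x :=
          norm_integral_le_of_norm_le hindi (Eventually.of_forall hle)
      _ = ∫ x in c..d, (v (x + δ) - v x) := by
          rw [integral_indicator measurableSet_Icc, integral_Icc_eq_integral_Ioc,
            intervalIntegral.integral_of_le hcd]
      -- The two integrals overlap on [c+δ, d], which cancels and leaves two end pieces of length δ.
      _ = (∫ x in d..(d + δ), v x) - ∫ x in c..(c + δ), v x := by
          rw [intervalIntegral.integral_sub hvi hvi', intervalIntegral.integral_comp_add_right]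
          have e1 := intervalIntegral.integral_add_adjacent_intervals
            (hii c (c + δ) le_rfl (by linarith) (by linarith))
            (hii (c + δ) (d + δ) (by linarith) (by linarith) le_rfl)
          have e2 := intervalIntegral.integral_add_adjacent_intervals hvi'
            (hii d (d + δ) hcd (by linarith) le_rfl)
          linarith
      _ ≤ B * δ - 0 := by
          refine sub_le_sub ?_ ?_
          · have := intervalIntegral.integral_mono_on (by linarith)
              (hii d (d + δ) hcd (by linarith) le_rfl)
              (intervalIntegrable_const (c := B)) (fun x _ => hvB x)
            simpa [mul_comm] using this
          · refine intervalIntegral.integral_nonneg (by linarith) fun x hx => ?_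
            rw [← hvc]
            exact hvm hcI (hsub ⟨hx.1, hx.2.trans (by linarith)⟩) hx.1
      _ = B * δ := sub_zero _
  have hd : Continuous (deriv ψ) := hψ.continuous_deriv (by norm_num)
  obtain ⟨C, hC⟩ := hc.deriv.exists_bound_of_continuous hd
  have hder : HasDerivAt (fun δ => ∫ x, ψ (x - δ) * q x) (∫ x, -deriv ψ (x - 0) * q x) 0 := by
    refine (hasDerivAt_integral_of_dominated_loc_of_deriv_le (F := fun δ x => ψ (x - δ) * q x)
      (F' := fun δ x => -deriv ψ (x - δ) * q x) (bound := fun x => C * ‖q x‖) univ_mem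
      (Eventually.of_forall fun δ => (hint δ).aestronglyMeasurable) (hint 0) ?_ ?_
      (hq.norm.const_mul C) ?_).2
    · exact ((hd.comp (by fun_prop)).neg.aestronglyMeasurable).mul hq.aestronglyMeasurable
    · refine Eventually.of_forall fun x δ _ => ?_
      rw [norm_mul, norm_neg]
      gcongr
      exact hC _
    · refine Eventually.of_forall fun x δ _ => HasDerivAt.mul_const ?_ (q x)
      have h2 : HasDerivAt (fun δ : ℝ => x - δ) (-1) δ := by
        simpa using (hasDerivAt_id δ).const_sub x
      have h3 := ((hψ.differentiable (by norm_num)) (x - δ)).hasDerivAt.comp δ h2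
      rw [mul_neg, mul_one] at h3
      exact h3
  have hslope := (hasDerivAt_iff_tendsto_slope.1 hder).mono_left
    (nhdsWithin_mono (0 : ℝ) (show Ioi (0 : ℝ) ⊆ {0}ᶜ from fun x hx => ne_of_gt hx))
  have hfin := le_of_tendsto (hslope.norm) (b := B) ?_
  · simpa [integral_neg] using hfin
  have hnear : ∀ᶠ δ in 𝓝[>] (0 : ℝ), d + δ ∈ I := by
    have : Tendsto (fun δ : ℝ => d + δ) (𝓝[>] 0) (𝓝 d) := by
      have h2 : Continuous fun δ : ℝ => d + δ := by fun_prop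
      simpa using (h2.tendsto 0).mono_left nhdsWithin_le_nhds
    exact this (hI.mem_nhds hdI)
  filter_upwards [hnear, self_mem_nhdsWithin] with δ h2 hδ
  have hδ' : (0 : ℝ) < δ := hδ
  rw [slope_def_field, sub_zero, norm_div, Real.norm_of_nonneg hδ'.le, div_le_iff₀ hδ']
  exact hdiff δ hδ' h2

/-! ### Duality between `L¹` and test functions -/

/-- Mollify g: the mollifications stay bounded by 1, are supported in a thickening of K inside I,
and converge to g almost everywhere, so dominated convergence applies. -/
theorem integral_indicator_sign_mul_le {z : ℝ → ℝ} {I K : Set ℝ} (hI : IsOpen I)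
    (hK : IsCompact K) (hKI : K ⊆ I) (hz : Integrable z) {B : ℝ}
    (h : ∀ ψ : ℝ → ℝ, ContDiff ℝ 1 ψ → HasCompactSupport ψ → tsupport ψ ⊆ I →
      (∀ x, |ψ x| ≤ 1) → |∫ x, ψ x * z x| ≤ B) {g : ℝ → ℝ} (hg : AEStronglyMeasurable g)
    (hg1 : ∀ x, |g x| ≤ 1) (hgK : Function.support g ⊆ K) : ∫ x, g x * z x ≤ B := by
  have hgint : Integrable g := by
    have h1 : IntegrableOn g K :=
      Measure.integrableOn_of_bounded (M := 1) hK.measure_lt_top.ne hg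
        (Eventually.of_forall hg1)
    exact (integrableOn_iff_integrable_of_support_subset hgK).1 h1
  obtain ⟨r, hr, hrI⟩ := hK.exists_cthickening_subset_open hI hKI
  -- The ratio of outer to inner radius is kept equal to 2, as the almost everywhere convergence
  -- needs it bounded.
  let φ : ℕ → ContDiffBump (0 : ℝ) := fun k =>
    ⟨r / 2 / (k + 1), r / (k + 1), by positivity, by gcongr; linarith⟩
  have hφ : Tendsto (fun k => (φ k).rOut) atTop (𝓝 0) := by
    simpa [φ, div_eq_mul_inv] using (tendsto_one_div_add_atTop_nhds_zero_nat (𝕜 := ℝ)).const_mul r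
  have hrout : ∀ k, (φ k).rOut ≤ r := fun k =>
    div_le_self hr.le (by linarith [Nat.cast_nonneg (α := ℝ) k])
  let ψ : ℕ → ℝ → ℝ := fun k =>
    convolution ((φ k).normed volume) g (ContinuousLinearMap.lsmul ℝ ℝ) volume
  have hlim : ∀ᵐ x, Tendsto (fun k => ψ k x) atTop (𝓝 (g x)) :=
    ContDiffBump.ae_convolution_tendsto_right_of_locallyIntegrable (K := 2) hφ
      (Eventually.of_forall fun k => by
        simp only [φ]
        apply le_of_eq
        ring) hgint.locallyIntegrable
  have hψs : ∀ k, tsupport (ψ k) ⊆ Metric.cthickening r K := by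
    intro k
    refine closure_minimal (fun x hx => ?_) Metric.isClosed_cthickening
    obtain ⟨y, hy, w, hw, rfl⟩ := support_convolution_subset (ContinuousLinearMap.lsmul ℝ ℝ) hx
    rw [(φ k).support_normed_eq, mem_ball_zero_iff] at hy
    refine Metric.mem_cthickening_of_dist_le _ w r K (hgK hw) ?_
    rw [dist_eq_norm, show y + w - w = y by ring]
    exact hy.le.trans (hrout k)
  have hψc : ∀ k, HasCompactSupport (ψ k) := fun k =>
    hK.cthickening.of_isClosed_subset (isClosed_tsupport _) (hψs k)
  have hψd : ∀ k, ContDiff ℝ 1 (ψ k) := fun k =>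
    (φ k).hasCompactSupport_normed.contDiff_convolution_left _ (φ k).contDiff_normed
      hgint.locallyIntegrable
  have hψ1 : ∀ k x, |ψ k x| ≤ 1 := by
    intro k x
    have h1 : ‖ψ k x‖ ≤ ∫ t, (φ k).normed volume t := by
      refine norm_integral_le_of_norm_le (φ k).integrable_normed (Eventually.of_forall fun t => ?_)
      rw [ContinuousLinearMap.lsmul_apply, norm_smul, Real.norm_of_nonneg ((φ k).nonneg_normed t)]
      exact mul_le_of_le_one_right ((φ k).nonneg_normed t) (hg1 _)
    rwa [(φ k).integral_normed] at h1
  have hconv : Tendsto (fun k => ∫ x, ψ k x * z x) atTop (𝓝 (∫ x, g x * z x)) := by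
    refine tendsto_integral_of_dominated_convergence (fun x => ‖z x‖)
      (fun k => (hψd k).continuous.aestronglyMeasurable.mul hz.aestronglyMeasurable) hz.norm
      (fun k => Eventually.of_forall fun x => ?_) ?_
    · rw [norm_mul]
      exact mul_le_of_le_one_left (norm_nonneg _) (hψ1 k x)
    · filter_upwards [hlim] with x hx using hx.mul_const _
  exact le_of_tendsto' hconv fun k => (le_abs_self _).trans
    (h (ψ k) (hψd k) (hψc k) ((hψs k).trans hrI) (hψ1 k))

/-- Inner regularity of the finite measure |z|dx reduces I to a compact K; the bound is then tested
with the sign of z cut off to K. -/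
theorem setLIntegral_enorm_le_of_forall_test {z : ℝ → ℝ} {I : Set ℝ} (hI : IsOpen I)
    (hz : Integrable z) {B : ℝ}
    (h : ∀ ψ : ℝ → ℝ, ContDiff ℝ 1 ψ → HasCompactSupport ψ → tsupport ψ ⊆ I →
      (∀ x, |ψ x| ≤ 1) → |∫ x, ψ x * z x| ≤ B) :
    ∫⁻ x in I, ‖z x‖ₑ ≤ ENNReal.ofReal B := by
  let ν : Measure ℝ := volume.withDensity fun x => ‖z x‖ₑ
  have : IsFiniteMeasure ν := isFiniteMeasure_withDensity hz.2.ne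
  rw [← withDensity_apply _ hI.measurableSet]
  change ν I ≤ _
  rw [hI.measure_eq_iSup_isCompact]
  refine iSup₂_le fun K hKI => iSup_le fun hK => ?_
  simp only [ν]
  rw [withDensity_apply _ hK.measurableSet]
  have hzK : IntegrableOn z K := hz.integrableOn
  rw [← ofReal_integral_norm_eq_lintegral_enorm hzK]
  refine ENNReal.ofReal_le_ofReal ?_
  rw [← integral_indicator hK.measurableSet]
  have hsgn : ∀ x, K.indicator (fun x => if z x < 0 then (-1 : ℝ) else 1) x * z x =
      K.indicator (fun x => ‖z x‖) x := by
    intro x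
    by_cases hx : x ∈ K
    · rw [indicator_of_mem hx, indicator_of_mem hx, Real.norm_eq_abs]
      split_ifs with h1
      · rw [abs_of_neg h1, neg_one_mul]
      · rw [abs_of_nonneg (not_lt.1 h1), one_mul]
    · rw [indicator_of_notMem hx, indicator_of_notMem hx, zero_mul]
  rw [← integral_congr_ae (Eventually.of_forall hsgn)]
  refine integral_indicator_sign_mul_le hI hK hKI hz h ?_ ?_ (support_indicator_subset)
  · refine AEStronglyMeasurable.indicator ?_ hK.measurableSet
    have hm : Measurable fun y : ℝ => if y < 0 then (-1 : ℝ) else 1 :=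
      Measurable.ite measurableSet_Iio measurable_const measurable_const
    exact (hm.comp_aemeasurable hz.aemeasurable).aestronglyMeasurable
  · intro x
    by_cases hx : x ∈ K
    · rw [indicator_of_mem hx]
      split_ifs <;> simp
    · simp [indicator_of_notMem hx]

/-! ### Weak solutions tested along characteristics -/

/-- The map `t ↦ v(t,·)` is continuous on `[T₀, ∞[` with values in `L¹(ℝ)`. -/
structure ContinuousInL1 {E : Type*} [NormedAddCommGroup E] (T₀ : ℝ) (v : ℝ → ℝ → E) : Prop where
  integrable : ∀ t, T₀ ≤ t → Integrable (v t)
  tendsto : ∀ t, T₀ ≤ t → Tendsto (fun s => ∫ x, ‖v s x - v t x‖) (𝓝[Ici T₀] t) (𝓝 0)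

theorem ContinuousInL1.of_norm_sub_le {E F : Type*} [NormedAddCommGroup E] [NormedAddCommGroup F]
    {T₀ : ℝ} {v : ℝ → ℝ → E} (hv : ContinuousInL1 T₀ v) {w : ℝ → ℝ → F}
    (hw : ∀ t, T₀ ≤ t → Integrable (w t)) {K : ℝ}
    (h : ∀ s t, T₀ ≤ s → T₀ ≤ t → ∀ x, ‖w s x - w t x‖ ≤ K * ‖v s x - v t x‖) :
    ContinuousInL1 T₀ w := by
  refine ⟨hw, fun t ht => ?_⟩
  have h1 := (hv.tendsto t ht).const_mul K
  rw [mul_zero] at h1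
  refine squeeze_zero' (Eventually.of_forall fun s => integral_nonneg fun x => norm_nonneg _) ?_ h1
  filter_upwards [self_mem_nhdsWithin] with s hs
  rw [← integral_const_mul]
  exact integral_mono ((hw s hs).sub (hw t ht)).norm
    (((hv.integrable s hs).sub (hv.integrable t ht)).norm.const_mul K) (h s t hs ht)

theorem ContinuousInL1.clm_comp {E : Type*} [NormedAddCommGroup E] [NormedSpace ℝ E]
    {T₀ : ℝ} {v : ℝ → ℝ → E} (hv : ContinuousInL1 T₀ v) (l : E →L[ℝ] ℝ) :
    ContinuousInL1 T₀ fun t x => l (v t x) :=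
  hv.of_norm_sub_le (fun t ht => l.integrable_comp (hv.integrable t ht))
    fun s t _ _ x => by rw [← map_sub]; exact l.le_opNorm _

theorem ContinuousInL1.zero (T₀ : ℝ) : ContinuousInL1 T₀ fun _ _ => (0 : ℝ) :=
  ⟨fun _ _ => integrable_zero _ _ _, fun _ _ => by simp [tendsto_const_nhds]⟩

theorem ContinuousInL1.mono {E : Type*} [NormedAddCommGroup E] {T₀ T₁ : ℝ} {v : ℝ → ℝ → E}
    (hv : ContinuousInL1 T₀ v) (h : T₀ ≤ T₁) : ContinuousInL1 T₁ v :=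
  ⟨fun t ht => hv.integrable t (h.trans ht), fun t ht => (hv.tendsto t (h.trans ht)).mono_left
    (nhdsWithin_mono _ (Ici_subset_Ici.2 h))⟩

theorem LipschitzInL1.continuousInL1 {n : ℕ} {u : ℝ → ℝ → State n} (hu : LipschitzInL1 u) :
    ContinuousInL1 0 u := by
  obtain ⟨h1, L, hL⟩ := hu
  refine ⟨h1, fun t ht => ?_⟩
  have h2 : Tendsto (fun s => L * |s - t|) (𝓝[Ici 0] t) (𝓝 0) := by
    have h3 : Continuous fun s => L * |s - t| := by fun_prop
    simpa using (h3.tendsto t).mono_left nhdsWithin_le_nhds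
  refine squeeze_zero' (Eventually.of_forall fun s => integral_nonneg fun x => norm_nonneg _) ?_ h2
  filter_upwards [self_mem_nhdsWithin] with s hs using hL t s ht hs

/-- Moving θ with v(t,·) fixed is handled by dominated convergence; replacing v(t,·) by v(s,·) costs
at most sup|θ| times their L¹ distance. -/
theorem ContinuousInL1.continuousOn_integral_mul {T₀ : ℝ} {v : ℝ → ℝ → ℝ}
    (hv : ContinuousInL1 T₀ v) {θ : ℝ → ℝ} (hθ : Continuous θ) (hc : HasCompactSupport θ)
    (lam : ℝ) : ContinuousOn (fun t => ∫ x, θ (x - lam * t) * v t x) (Ici T₀) := by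
  obtain ⟨C, hC⟩ := hc.exists_bound_of_continuous hθ
  have hm : ∀ s, AEStronglyMeasurable (fun x => θ (x - lam * s)) (volume : Measure ℝ) := fun s =>
    (hθ.comp (by fun_prop)).aestronglyMeasurable
  have hint : ∀ s g, Integrable g → Integrable fun x => θ (x - lam * s) * g x := fun s g hg =>
    hg.bdd_mul (hm s) (Eventually.of_forall fun x => hC _)
  intro t ht
  have h1 : Tendsto (fun s => ∫ x, θ (x - lam * s) * v t x) (𝓝[Ici T₀] t)
      (𝓝 (∫ x, θ (x - lam * t) * v t x)) := by
    have : Continuous fun s => ∫ x, θ (x - lam * s) * v t x := by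
      refine continuous_of_dominated (bound := fun x => C * ‖v t x‖)
        (fun s => (hint s _ (hv.integrable t ht)).aestronglyMeasurable)
        (fun s => Eventually.of_forall fun x => ?_) ((hv.integrable t ht).norm.const_mul C)
        (Eventually.of_forall fun x => ?_)
      · rw [norm_mul]
        gcongr
        exact hC _
      · exact (hθ.comp (by fun_prop)).mul continuous_const
    exact (this.tendsto t).mono_left nhdsWithin_le_nhds
  have h2 : Tendsto (fun s => ∫ x, θ (x - lam * s) * (v s x - v t x)) (𝓝[Ici T₀] t) (𝓝 0) := by
    have h3 := (hv.tendsto t ht).const_mul C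
    rw [mul_zero] at h3
    refine squeeze_zero_norm' ?_ h3
    filter_upwards [self_mem_nhdsWithin] with s hs
    rw [← integral_const_mul]
    refine norm_integral_le_of_norm_le
      (((hv.integrable s hs).sub (hv.integrable t ht)).norm.const_mul C)
      (Eventually.of_forall fun x => ?_)
    rw [norm_mul]
    gcongr
    exact hC _
  have h4 := h2.add h1
  rw [zero_add] at h4
  refine h4.congr' ?_
  filter_upwards [self_mem_nhdsWithin] with s hs
  rw [← integral_add (hint s (fun x => v s x - v t x) ((hv.integrable s hs).sub (hv.integrable t ht)))
    (hint s _ (hv.integrable t ht))]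
  congr 1
  ext x
  ring

theorem integrable_smul_of_tsupport_subset {n : ℕ} {Ω : Set (ℝ × ℝ)} {w : ℝ × ℝ → State n}
    (hw : LocallyIntegrableOn w Ω) {g : ℝ × ℝ → ℝ} (hg : Continuous g) {K : Set (ℝ × ℝ)}
    (hK : IsCompact K) (hgK : ∀ p, p ∉ K → g p = 0) (hKΩ : K ⊆ Ω) :
    Integrable fun p => g p • w p := by
  have h1 : IntegrableOn (fun p => g p • w p) K :=
    (hw.integrableOn_compact_subset hKΩ hK).continuousOn_smul hg.continuousOn hK
  refine (integrableOn_iff_integrable_of_support_subset fun p hp => ?_).1 h1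
  by_contra h
  exact hp (by simp [hgK p h])

/-- A weak solution tested with a function that is constant along the lines of speed `lam`. -/
theorem IsWeakSolution.integral_transport {n : ℕ} {f : State n → State n} {T₀ : ℝ}
    {w : ℝ → ℝ → State n} (hw : IsWeakSolution f (Ioi T₀ ×ˢ univ) w) (hwc : ContinuousInL1 T₀ w)
    (l : State n →L[ℝ] ℝ) (lam c : ℝ) {q : ℝ → ℝ → ℝ} (hqc : ContinuousInL1 T₀ q)
    (hq : ∀ t x, l (f (w t x)) = lam * l (w t x) + q t x + c) {ψ : ℝ → ℝ}
    (hψ : ContDiff ℝ 1 ψ) (hψc : HasCompactSupport ψ) {t : ℝ} (ht : T₀ ≤ t) :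
    (∫ x, ψ (x - lam * t) * l (w t x)) - ∫ x, ψ (x - lam * T₀) * l (w T₀ x) =
      ∫ r in T₀..t, ∫ x, deriv ψ (x - lam * r) * q r x := by
  have hψ' : Continuous (deriv ψ) := hψ.continuous_deriv (by norm_num)
  have hlw := hwc.clm_comp l
  refine sub_eq_integral_of_weak_deriv
    (F := fun r => ∫ x, ψ (x - lam * r) * l (w r x))
    (hlw.continuousOn_integral_mul hψ.continuous hψc lam)
    (hqc.continuousOn_integral_mul hψ' hψc.deriv lam) (fun χ hχ hχc hχs => ?_) ht
  have hχ' : Continuous (deriv χ) := hχ.continuous_deriv (by norm_num)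
  let L : ℝ × ℝ →L[ℝ] ℝ := ContinuousLinearMap.snd ℝ ℝ ℝ - lam • ContinuousLinearMap.fst ℝ ℝ ℝ
  have hL : ∀ p : ℝ × ℝ, L p = p.2 - lam * p.1 := fun p => rfl
  -- With φ(t,x) = χ(t)ψ(x − lam·t) one has φ_t + lam·φ_x = χ′ψ, so the linear part of the flux
  -- leaves only the time derivative of χ.
  let φ : ℝ × ℝ → ℝ := fun p => χ p.1 * ψ (L p)
  have hφ : ContDiff ℝ 1 φ := (hχ.comp contDiff_fst).mul (hψ.comp L.contDiff)
  let K : Set (ℝ × ℝ) := (fun p : ℝ × ℝ => (p.1, p.2 + lam * p.1)) '' (tsupport χ ×ˢ tsupport ψ)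
  have hK : IsCompact K := (hχc.isCompact.prod hψc.isCompact).image (by fun_prop)
  have hKmem : ∀ p, p ∉ K → p.1 ∉ tsupport χ ∨ L p ∉ tsupport ψ := by
    intro p hp
    by_contra! h
    exact hp ⟨(p.1, L p), ⟨h.1, h.2⟩, by simp [hL]⟩
  have hKΩ : K ⊆ Ioi T₀ ×ˢ univ := by
    rintro _ ⟨p, hp, rfl⟩
    exact ⟨hχs hp.1, mem_univ _⟩
  have zχ : ∀ r, r ∉ tsupport χ → χ r = 0 ∧ deriv χ r = 0 := fun r hr =>
    ⟨image_eq_zero_of_notMem_tsupport hr, by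
      by_contra h
      exact hr (support_deriv_subset h)⟩
  have zψ : ∀ r, r ∉ tsupport ψ → ψ r = 0 ∧ deriv ψ r = 0 := fun r hr =>
    ⟨image_eq_zero_of_notMem_tsupport hr, by
      by_contra h
      exact hr (support_deriv_subset h)⟩
  have hφs : tsupport φ ⊆ K := by
    refine closure_minimal (fun p hp => ?_) hK.isClosed
    by_contra h
    rcases hKmem p h with h1 | h1
    · exact hp (by simp [φ, (zχ _ h1).1])
    · exact hp (by simp [φ, (zψ _ h1).1])
  have hφc : HasCompactSupport φ := hK.of_isClosed_subset (isClosed_tsupport _) hφs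
  have hd : ∀ p : ℝ × ℝ, HasFDerivAt φ (χ p.1 • (deriv ψ (L p) • L) +
      ψ (L p) • (deriv χ p.1 • ContinuousLinearMap.fst ℝ ℝ ℝ)) p := by
    intro p
    have h1 : HasFDerivAt (fun p : ℝ × ℝ => χ p.1)
        (deriv χ p.1 • ContinuousLinearMap.fst ℝ ℝ ℝ) p :=
      ((hχ.differentiable (by norm_num)) p.1).hasDerivAt.comp_hasFDerivAt p hasFDerivAt_fst
    have h2 : HasFDerivAt (fun p : ℝ × ℝ => ψ (L p)) (deriv ψ (L p) • L) p :=
      ((hψ.differentiable (by norm_num)) (L p)).hasDerivAt.comp_hasFDerivAt p L.hasFDerivAt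
    exact h1.mul h2
  let g₁ : ℝ × ℝ → ℝ := fun p => deriv χ p.1 * ψ (L p) - lam * (χ p.1 * deriv ψ (L p))
  let g₂ : ℝ × ℝ → ℝ := fun p => χ p.1 * deriv ψ (L p)
  have hd1 : ∀ p, fderiv ℝ φ p (1, 0) = g₁ p := by
    intro p
    rw [(hd p).fderiv]
    simp [g₁, hL]
    ring
  have hd2 : ∀ p, fderiv ℝ φ p (0, 1) = g₂ p := by
    intro p
    rw [(hd p).fderiv]
    simp [g₂, hL]
  have hg₁ : Continuous g₁ := by
    have e1 : Continuous fun p : ℝ × ℝ => deriv χ p.1 := hχ'.comp continuous_fst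
    have e2 : Continuous fun p : ℝ × ℝ => χ p.1 := hχ.continuous.comp continuous_fst
    have e3 : Continuous fun p : ℝ × ℝ => ψ (L p) := hψ.continuous.comp L.continuous
    have e4 : Continuous fun p : ℝ × ℝ => deriv ψ (L p) := hψ'.comp L.continuous
    exact (e1.mul e3).sub (continuous_const.mul (e2.mul e4))
  have hg₂ : Continuous g₂ := (hχ.continuous.comp continuous_fst).mul (hψ'.comp L.continuous)
  have i1 : Integrable fun p : ℝ × ℝ => g₁ p • w p.1 p.2 := by
    refine integrable_smul_of_tsupport_subset hw.locallyIntegrable hg₁ hK (fun p hp => ?_) hKΩ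
    rcases hKmem p hp with h1 | h1
    · simp [g₁, zχ _ h1]
    · simp [g₁, zψ _ h1]
  have i2 : Integrable fun p : ℝ × ℝ => g₂ p • f (w p.1 p.2) := by
    refine integrable_smul_of_tsupport_subset hw.locallyIntegrable_flux hg₂ hK (fun p hp => ?_) hKΩ
    rcases hKmem p hp with h1 | h1
    · simp [g₂, zχ _ h1]
    · simp [g₂, zψ _ h1]
  have h0 := hw.integral_eq_zero φ hφ hφc (hφs.trans hKΩ)
  simp only [hd1, hd2] at h0
  have h1 := congrArg l h0
  have i3 : Integrable fun p : ℝ × ℝ => g₁ p • w p.1 p.2 + g₂ p • f (w p.1 p.2) := i1.add i2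
  rw [← l.integral_comp_comm i3.integrableOn, map_zero] at h1
  have hi := l.integrable_comp i3
  rw [Measure.volume_eq_prod] at h1 hi
  rw [setIntegral_prod _ hi.integrableOn] at h1
  rw [← h1]
  refine setIntegral_congr_fun measurableSet_Ioi fun r hr => ?_
  have hr' : T₀ ≤ r := le_of_lt (mem_Ioi.1 hr)
  simp only [setIntegral_univ]
  -- This removes the constant c of the flux, which is not integrable over the line.
  have hc0 : ∫ x, deriv ψ (x - lam * r) = 0 := by
    rw [integral_sub_right_eq_self (deriv ψ)]
    exact integral_eq_zero_of_hasDerivAt_of_integrable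
      (fun x => ((hψ.differentiable (by norm_num)) x).hasDerivAt)
      (hψ'.integrable_of_hasCompactSupport hψc.deriv)
      (hψ.continuous.integrable_of_hasCompactSupport hψc)
  obtain ⟨C₁, hC₁⟩ := hψc.exists_bound_of_continuous hψ.continuous
  obtain ⟨C₂, hC₂⟩ := hψc.deriv.exists_bound_of_continuous hψ'
  have j1 : Integrable fun x => ψ (x - lam * r) * l (w r x) :=
    (hlw.integrable r hr').bdd_mul (hψ.continuous.comp (by fun_prop)).aestronglyMeasurable
      (Eventually.of_forall fun x => hC₁ _)
  have j2 : Integrable fun x => deriv ψ (x - lam * r) * q r x :=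
    (hqc.integrable r hr').bdd_mul (hψ'.comp (by fun_prop)).aestronglyMeasurable
      (Eventually.of_forall fun x => hC₂ _)
  have j3 : Integrable fun x => deriv ψ (x - lam * r) :=
    (hψ'.integrable_of_hasCompactSupport hψc.deriv).comp_sub_right _
  have hpt : ∀ x, l (g₁ (r, x) • w r x + g₂ (r, x) • f (w r x)) =
      deriv χ r * (ψ (x - lam * r) * l (w r x)) + χ r * (deriv ψ (x - lam * r) * q r x) +
        (χ r * c) * deriv ψ (x - lam * r) := by
    intro x
    simp only [map_add, map_smul, smul_eq_mul, hq, g₁, g₂, hL]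
    ring
  simp only [hpt]
  have j4 : Integrable fun x => deriv χ r * (ψ (x - lam * r) * l (w r x)) +
      χ r * (deriv ψ (x - lam * r) * q r x) := (j1.const_mul _).add (j2.const_mul _)
  rw [integral_add j4 (j3.const_mul _),
    integral_add (j1.const_mul _) (j2.const_mul _), integral_const_mul, integral_const_mul,
    integral_const_mul, hc0, mul_zero, add_zero]

/-! ### Shrinking intervals -/

/-- Moving the shift from the extended endpoints to the real point treats finite and infinite
endpoints alike. -/
theorem mem_shrink_iff {a b : EReal} {h x : ℝ} :
    x ∈ shrink a b h ↔ a < ((x - h : ℝ) : EReal) ∧ ((x + h : ℝ) : EReal) < b := by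
  have h1 : a + (h : EReal) < (x : EReal) ↔ a < ((x - h : ℝ) : EReal) := by
    induction a using EReal.rec with
    | bot => simp [-EReal.coe_sub, EReal.bot_lt_coe]
    | top => simp
    | coe a =>
      rw [← EReal.coe_add, EReal.coe_lt_coe_iff, EReal.coe_lt_coe_iff]
      exact lt_sub_iff_add_lt.symm
  have h2 : (x : EReal) < b - (h : EReal) ↔ ((x + h : ℝ) : EReal) < b := by
    induction b using EReal.rec with
    | bot => simp
    | top => simp [-EReal.coe_add, EReal.coe_lt_top]
    | coe b =>
      rw [← EReal.coe_sub, EReal.coe_lt_coe_iff, EReal.coe_lt_coe_iff]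
      exact lt_sub_iff_add_lt
  exact and_congr h1 h2

theorem isOpen_shrink (a b : EReal) (h : ℝ) : IsOpen (shrink a b h) :=
  isOpen_Ioo.preimage continuous_coe_real_ereal

theorem ordConnected_shrink (a b : EReal) (h : ℝ) : (shrink a b h).OrdConnected :=
  ⟨fun _ hx _ hy _ hz => ⟨hx.1.trans_le (EReal.coe_le_coe_iff.2 hz.1),
    (EReal.coe_le_coe_iff.2 hz.2).trans_lt hy.2⟩⟩

/-- This is the domain of dependence: a backward line of speed at most 1 from the shrunken interval
stays in the trapezoid. -/
theorem mem_shrink_of_abs_sub_le {a b : EReal} {h h' x y : ℝ} (hy : y ∈ shrink a b h)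
    (hxy : |x - y| ≤ h - h') : x ∈ shrink a b h' := by
  rw [mem_shrink_iff] at hy ⊢
  rw [abs_le] at hxy
  exact ⟨hy.1.trans_le (EReal.coe_le_coe_iff.2 (by linarith [hxy.1])),
    (EReal.coe_le_coe_iff.2 (by linarith [hxy.2])).trans_lt hy.2⟩

theorem shrink_zero (a b : EReal) :
    shrink a b 0 = {x : ℝ | a < (x : EReal) ∧ (x : EReal) < b} := by
  ext x
  simp [shrink]

theorem exists_Icc_subset_shrink {a b : EReal} {ξ : ℝ} (ha : a < (ξ : EReal))
    (hb : (ξ : EReal) < b) : ∃ η : ℝ, 0 < η ∧ ∀ h ≤ η, Icc ξ (ξ + η) ⊆ shrink a b h := by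
  have hξ : ξ ∈ shrink a b 0 := by rw [shrink_zero]; exact ⟨ha, hb⟩
  obtain ⟨r, hr, hsub⟩ := Metric.isOpen_iff.1 (isOpen_shrink a b 0) ξ hξ
  have hm : ∀ y, |y - ξ| < r → y ∈ shrink a b 0 := fun y hy => hsub hy
  refine ⟨r / 3, by positivity, fun h hh x hx => ?_⟩
  have h1 := hm (ξ - r / 3) (by rw [abs_lt]; constructor <;> linarith)
  have h2 := hm (ξ + 2 * r / 3) (by rw [abs_lt]; constructor <;> linarith)
  rw [mem_shrink_iff] at h1 h2 ⊢
  exact ⟨h1.1.trans_le (EReal.coe_le_coe_iff.2 (by linarith [hx.1])),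
    (EReal.coe_le_coe_iff.2 (by linarith [hx.2])).trans_lt h2.2⟩

/-! ### Pointwise bounds -/

theorem norm_sub_le_of_eVariationOn_le {E : Type*} [NormedAddCommGroup E] {v : ℝ → E}
    {S : Set ℝ} {M : ℝ≥0} (hM : eVariationOn v S ≤ M) {x y : ℝ} (hx : x ∈ S) (hy : y ∈ S) :
    ‖v x - v y‖ ≤ M := by
  have h1 := (eVariationOn.edist_le v hx hy).trans hM
  rw [edist_nndist, ENNReal.coe_le_coe] at h1
  rw [← dist_eq_norm]
  exact_mod_cast h1

/-- If the norm exceeded M at one point, it would be bounded below by a positive constant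
everywhere, contradicting integrability. -/
theorem norm_le_of_integrable_of_eVariationOn_le {E : Type*} [NormedAddCommGroup E] {v : ℝ → E}
    (hv : Integrable v) {M : ℝ≥0} (hM : eVariationOn v univ ≤ M) (x : ℝ) : ‖v x‖ ≤ M := by
  by_contra! hx
  have h1 : ∀ y, ‖v x‖ - M ≤ ‖v y‖ := fun y => by
    have h2 := norm_sub_le_of_eVariationOn_le hM (mem_univ x) (mem_univ y)
    linarith [norm_sub_norm_le (v x) (v y)]
  have h3 : Integrable fun _ : ℝ => ‖v x‖ - M :=
    hv.norm.mono' aestronglyMeasurable_const (Eventually.of_forall fun y => by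
      rw [Real.norm_of_nonneg (by linarith)]
      exact h1 y)
  rw [integrable_const_iff] at h3
  rcases h3 with h3 | h3
  · linarith
  · simp [isFiniteMeasure_iff] at h3

theorem exists_lipschitz_fderiv {n : ℕ} {f : State n → State n} (hf : ContDiff ℝ 2 f) (M : ℝ) :
    ∃ K : ℝ, 0 ≤ K ∧ ∀ v w, ‖v‖ ≤ M → ‖w‖ ≤ M →
      ‖fderiv ℝ f v - fderiv ℝ f w‖ ≤ K * ‖v - w‖ := by
  have h1 : ContDiff ℝ 1 (fderiv ℝ f) := hf.fderiv_right (by norm_num)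
  obtain ⟨K, hK⟩ := (isCompact_closedBall (0 : State n) M).exists_bound_of_continuousOn
    (h1.continuous_fderiv (by norm_num)).continuousOn
  refine ⟨max K 0, le_max_right _ _, fun v w hv hw => ?_⟩
  exact (convex_closedBall (0 : State n) M).norm_image_sub_le_of_norm_fderiv_le
    (fun x _ => (h1.differentiable (by norm_num)) x) (fun x hx => (hK x hx).trans (le_max_left _ _))
    (by simpa using hw) (by simpa using hv)

/-- The nonlinear part of the flux `f` relative to the state `v₀`, normalized to vanish at `0`. -/
noncomputable def fluxRemainder {n : ℕ} (f : State n → State n) (v₀ v : State n) : State n :=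
  f v - f 0 - fderiv ℝ f v₀ v

/-- The derivative of the remainder at x is Df(x) − Df(v₀), of norm at most K·R on the intersection
of the two balls, which is convex. -/
theorem norm_fluxRemainder_sub_le {n : ℕ} {f : State n → State n} (hf : Differentiable ℝ f)
    {M K R : ℝ} (hK0 : 0 ≤ K) (hK : ∀ v w, ‖v‖ ≤ M → ‖w‖ ≤ M →
      ‖fderiv ℝ f v - fderiv ℝ f w‖ ≤ K * ‖v - w‖) {v₀ v w : State n} (h₀ : ‖v₀‖ ≤ M)
    (hv : ‖v‖ ≤ M) (hw : ‖w‖ ≤ M) (hvR : ‖v - v₀‖ ≤ R) (hwR : ‖w - v₀‖ ≤ R) :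
    ‖fluxRemainder f v₀ v - fluxRemainder f v₀ w‖ ≤ K * R * ‖v - w‖ := by
  have hconv : Convex ℝ (Metric.closedBall (0 : State n) M ∩ Metric.closedBall v₀ R) :=
    (convex_closedBall _ _).inter (convex_closedBall _ _)
  refine hconv.norm_image_sub_le_of_norm_hasFDerivWithin_le
    (f' := fun x => fderiv ℝ f x - fderiv ℝ f v₀) (fun x _ => ?_) (fun x hx => ?_) ?_ ?_
  · exact (((hf x).hasFDerivAt.sub_const (f 0)).sub (fderiv ℝ f v₀).hasFDerivAt).hasFDerivWithinAt
  · have hx1 : ‖x‖ ≤ M := by simpa using hx.1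
    have hx2 : ‖x - v₀‖ ≤ R := by simpa [dist_eq_norm] using hx.2
    exact (hK x v₀ hx1 h₀).trans (mul_le_mul_of_nonneg_left hx2 hK0)
  · exact ⟨by simpa using hw, by simpa [dist_eq_norm] using hwR⟩
  · exact ⟨by simpa using hv, by simpa [dist_eq_norm] using hvR⟩

theorem eVariationOn_fluxRemainder_le {n : ℕ} {f : State n → State n} (hf : Differentiable ℝ f)
    {M K R T : ℝ} (hK0 : 0 ≤ K) (hR0 : 0 ≤ R) (hK : ∀ v w, ‖v‖ ≤ M → ‖w‖ ≤ M →
      ‖fderiv ℝ f v - fderiv ℝ f w‖ ≤ K * ‖v - w‖) {v₀ : State n} (h₀ : ‖v₀‖ ≤ M)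
    {v : ℝ → State n} {S : Set ℝ} (hv : ∀ x, ‖v x‖ ≤ M) (hvR : ∀ x ∈ S, ‖v x - v₀‖ ≤ R)
    (hT : eVariationOn v S ≤ ENNReal.ofReal T) (l : State n →L[ℝ] ℝ) {Γ : ℝ} (hl : ‖l‖ ≤ Γ) :
    eVariationOn (fun x => l (fluxRemainder f v₀ (v x))) S ≤ ENNReal.ofReal (Γ * (K * R) * T) := by
  have hΓ : 0 ≤ Γ := (norm_nonneg _).trans hl
  have hc0 : 0 ≤ Γ * (K * R) := by positivity
  have hlip : LipschitzOnWith (Γ * (K * R)).toNNReal (fun y => l (fluxRemainder f v₀ y))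
      (v '' S) := by
    refine LipschitzOnWith.of_dist_le_mul ?_
    rintro _ ⟨x, hx, rfl⟩ _ ⟨y, hy, rfl⟩
    rw [Real.coe_toNNReal _ hc0, dist_eq_norm, dist_eq_norm, ← map_sub, mul_assoc]
    exact l.le_of_opNorm_le_of_le hl
      (norm_fluxRemainder_sub_le hf hK0 hK h₀ (hv x) (hv y) (hvR x hx) (hvR y hy))
  refine (hlip.comp_eVariationOn_le (mapsTo_image v S)).trans ?_
  rw [ENNReal.ofReal_mul hc0]
  exact mul_le_mul_right hT _

/-! ### Comparison with the linearized problem -/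

theorem IsWeakSolution.mono {n : ℕ} {f : State n → State n} {Ω Ω' : Set (ℝ × ℝ)}
    {u : ℝ → ℝ → State n} (hu : IsWeakSolution f Ω u) (h : Ω' ⊆ Ω) : IsWeakSolution f Ω' u := by
  refine ⟨hu.locallyIntegrable.mono_set h, hu.locallyIntegrable_flux.mono_set h,
    fun φ hφ hc hs => ?_⟩
  have h0 : ∀ p, p ∉ Ω' →
      fderiv ℝ φ p (1, 0) • u p.1 p.2 + fderiv ℝ φ p (0, 1) • f (u p.1 p.2) = 0 := by
    intro p hp
    have h1 : fderiv ℝ φ p = 0 := by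
      by_contra h2
      exact hp (hs (support_fderiv_subset ℝ h2))
    simp [h1]
  rw [setIntegral_eq_integral_of_forall_compl_eq_zero h0, ← hu.integral_eq_zero φ hφ hc (hs.trans h),
    setIntegral_eq_integral_of_forall_compl_eq_zero fun p hp => h0 p fun hp' => hp (h hp')]

/-- The states reached on the shrinking interval at times of small variation are close to the
reference state. -/
theorem eventually_norm_sub_le {n : ℕ} {u : ℝ → ℝ → State n} (hu : LipschitzInL1 u) {τ : ℝ}
    (hτ : 0 ≤ τ) {a b : EReal} {ε : ℝ≥0} {ξ : ℝ}
    (hvar : eVariationOn (u τ) {x : ℝ | a < (x : EReal) ∧ (x : EReal) < b} ≤ ε)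
    (ha : a < (ξ : EReal)) (hb : (ξ : EReal) < b) {δ : ℝ} (hδ : 0 < δ) :
    ∃ η : ℝ, 0 < η ∧ ∀ t, τ ≤ t → t ≤ τ + η → V u τ a b t ≤ 2 * (ε : ℝ≥0∞) →
      ∀ x ∈ shrink a b (t - τ), ‖u t x - u τ ξ‖ ≤ 3 * ε + δ := by
  obtain ⟨η, hη, hsub⟩ := exists_Icc_subset_shrink ha hb
  obtain ⟨hint, L, hL⟩ := hu
  have hL' : 0 < |L| + 1 := by positivity
  -- The second bound makes the L¹ distance between times τ and t at most δη/2.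
  refine ⟨min η (δ * η / (2 * (|L| + 1))), by positivity, fun t ht htη hV x hx => ?_⟩
  have ht1 : t - τ ≤ η := by linarith [min_le_left η (δ * η / (2 * (|L| + 1)))]
  have ht2 : t - τ ≤ δ * η / (2 * (|L| + 1)) := by
    linarith [min_le_right η (δ * η / (2 * (|L| + 1)))]
  have h0t : 0 ≤ t := hτ.trans ht
  have hdiff : Integrable fun y => u t y - u τ y := (hint t h0t).sub (hint τ hτ)
  -- Otherwise the L¹ distance would be at least δη. The triangle inequality through y then costs 2ε
  -- at time t, δ from τ to t, and ε at time τ.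
  obtain ⟨y, hy, hyδ⟩ : ∃ y ∈ Icc ξ (ξ + η), ‖u t y - u τ y‖ ≤ δ := by
    by_contra! hcon
    have h1 : δ * η ≤ ∫ y in Icc ξ (ξ + η), ‖u t y - u τ y‖ := by
      have h2 : ∫ _ in Icc ξ (ξ + η), δ ≤ ∫ y in Icc ξ (ξ + η), ‖u t y - u τ y‖ :=
        setIntegral_mono_on (by simp) hdiff.norm.integrableOn measurableSet_Icc
          fun y hy => (hcon y hy).le
      simpa [hη.le, mul_comm] using h2
    have h3 : ∫ y in Icc ξ (ξ + η), ‖u t y - u τ y‖ ≤ ∫ y, ‖u t y - u τ y‖ :=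
      setIntegral_le_integral hdiff.norm (Eventually.of_forall fun _ => norm_nonneg _)
    have h4 := hL τ t hτ h0t
    rw [abs_of_nonneg (by linarith : (0 : ℝ) ≤ t - τ)] at h4
    have h5 : L * (t - τ) ≤ (|L| + 1) * (t - τ) :=
      mul_le_mul_of_nonneg_right (by linarith [le_abs_self L]) (by linarith)
    have h6 : (|L| + 1) * (t - τ) ≤ δ * η / 2 := by
      calc (|L| + 1) * (t - τ) ≤ (|L| + 1) * (δ * η / (2 * (|L| + 1))) := by gcongr
        _ = δ * η / 2 := by field_simp
    have h7 : 0 < δ * η := by positivity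
    linarith
  have hV' : eVariationOn (u t) (shrink a b (t - τ)) ≤ ((2 * ε : ℝ≥0) : ℝ≥0∞) := by
    simpa [V] using hV
  have h1 : ‖u t x - u t y‖ ≤ ((2 * ε : ℝ≥0) : ℝ) :=
    norm_sub_le_of_eVariationOn_le hV' hx (hsub _ ht1 hy)
  rw [← shrink_zero] at hvar
  have h2 : ‖u τ y - u τ ξ‖ ≤ (ε : ℝ) :=
    norm_sub_le_of_eVariationOn_le hvar (hsub 0 hη.le hy) (hsub 0 hη.le ⟨le_rfl, by linarith⟩)
  push_cast at h1
  calc ‖u t x - u τ ξ‖ = ‖(u t x - u t y) + (u t y - u τ y) + (u τ y - u τ ξ)‖ := by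
        congr 1; abel
    _ ≤ ‖u t x - u t y‖ + ‖u t y - u τ y‖ + ‖u τ y - u τ ξ‖ := norm_add₃_le
    _ ≤ 3 * ε + δ := by linarith

/-- Along a left eigenvector `l` of `Df(v₀)`, the difference between the nonlinear and the linear
solution, tested on a shrunken interval, is the time integral of the tested flux remainder. -/
theorem integral_mul_sub_eq {n : ℕ} {f : State n → State n} {u W : ℝ → ℝ → State n} {τ : ℝ}
    {v₀ : State n} (hu : IsWeakSolution f (Ioi τ ×ˢ univ) u) (huc : ContinuousInL1 τ u)
    (hW : IsWeakCauchySolution (fun w => fderiv ℝ f v₀ w) τ (u τ) W) {l : State n →L[ℝ] ℝ}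
    {lam : ℝ} (hl : l.comp (fderiv ℝ f v₀) = lam • l)
    (hqc : ContinuousInL1 τ fun t x => l (fluxRemainder f v₀ (u t x)))
    {ψ : ℝ → ℝ} (hψ : ContDiff ℝ 1 ψ) (hψc : HasCompactSupport ψ) {h : ℝ} (hh : 0 ≤ h) :
    ∫ x, ψ x * l (u (τ + h) x - W (τ + h) x) =
      ∫ r in τ..(τ + h), ∫ x, deriv (fun y => ψ (y + lam * (τ + h))) (x - lam * r) *
        l (fluxRemainder f v₀ (u r x)) := by
  have hl' : ∀ v, l (fderiv ℝ f v₀ v) = lam * l v := fun v => by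
    simpa using congrArg (fun m : State n →L[ℝ] ℝ => m v) hl
  have hWc : ContinuousInL1 τ W := ⟨hW.integrable, hW.continuous⟩
  -- The shift makes the transported test function equal to ψ at the final time τ + h.
  have hΨ : ContDiff ℝ 1 fun y => ψ (y + lam * (τ + h)) := hψ.comp (contDiff_id.add contDiff_const)
  have hΨc : HasCompactSupport fun y => ψ (y + lam * (τ + h)) :=
    hψc.comp_homeomorph (Homeomorph.addRight (lam * (τ + h)))
  have hτh : τ ≤ τ + h := by linarith
  have e1 := hu.integral_transport huc l lam (l (f 0)) hqc (fun t x => by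
    simp only [fluxRemainder, map_sub, hl']; ring) hΨ hΨc hτh
  have e2 := hW.weak.integral_transport hWc l lam 0 (ContinuousInL1.zero τ) (fun t x => by
    simp only [hl']; ring) hΨ hΨc hτh
  have e3 : ∫ x, ψ (x - lam * τ + lam * (τ + h)) * l (W τ x) =
      ∫ x, ψ (x - lam * τ + lam * (τ + h)) * l (u τ x) := by
    refine integral_congr_ae ?_
    filter_upwards [hW.initial] with x hx
    rw [hx]
  simp only [mul_zero, integral_zero, intervalIntegral.integral_zero, sub_add_cancel] at e1 e2
  obtain ⟨C, hC⟩ := hψc.exists_bound_of_continuous hψ.continuous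
  have hi : ∀ w : ℝ → State n, Integrable w → Integrable fun x => ψ x * l (w x) := fun w hw =>
    (l.integrable_comp hw).bdd_mul hψ.continuous.aestronglyMeasurable (Eventually.of_forall hC)
  simp only [map_sub, mul_sub]
  rw [integral_sub (hi _ (huc.integrable _ hτh)) (hi _ (hWc.integrable _ hτh))]
  linarith

theorem abs_integral_deriv_shift_mul_le {q ψ : ℝ → ℝ} {a b : EReal} {B h h' s : ℝ} (hB0 : 0 ≤ B)
    (hq : Integrable q) (hs : |s| ≤ h - h')
    (hB : eVariationOn q (shrink a b h') ≤ ENNReal.ofReal B) (hψ : ContDiff ℝ 1 ψ)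
    (hc : HasCompactSupport ψ) (hψs : tsupport ψ ⊆ shrink a b h) (h1 : ∀ x, |ψ x| ≤ 1) :
    |∫ x, deriv ψ (x + s) * q x| ≤ B := by
  have hd : ∀ x, deriv ψ (x + s) = deriv (fun y => ψ (y + s)) x := fun x =>
    (deriv_comp_add_const ψ s x).symm
  simp only [hd]
  refine abs_integral_deriv_mul_le hB0 (isOpen_shrink a b h') (ordConnected_shrink a b h') hq hB
    (hψ.comp (contDiff_id.add contDiff_const)) (hc.comp_homeomorph (Homeomorph.addRight s)) ?_
    fun x => h1 _
  have hcl : IsClosed {x | x + s ∈ tsupport ψ} :=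
    (isClosed_tsupport ψ).preimage (continuous_add_const s)
  have hsub : tsupport (fun y => ψ (y + s)) ⊆ {x | x + s ∈ tsupport ψ} :=
    closure_minimal (fun x hx => subset_tsupport ψ hx) hcl
  refine hsub.trans fun x hx => ?_
  exact mem_shrink_of_abs_sub_le (hψs hx) (by rw [show x - (x + s) = -s by ring, abs_neg]; exact hs)

/-- S need not be measurable, so it is replaced by a measurable hull of the same measure. -/
theorem enorm_integral_le_of_bad_set {k : ℝ → ℝ} {τ h : ℝ} (hh : 0 ≤ h) {S : Set ℝ} {c₁ c₂ : ℝ}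
    (hgood : ∀ r ∈ Icc τ (τ + h), r ∉ S → |k r| ≤ c₁)
    (hbad : ∀ r ∈ Icc τ (τ + h), |k r| ≤ c₂) :
    ‖∫ r in τ..(τ + h), k r‖ₑ ≤
      ENNReal.ofReal c₁ * ENNReal.ofReal h + ENNReal.ofReal c₂ * volume S := by
  have hτh : τ ≤ τ + h := by linarith
  rw [intervalIntegral.integral_of_le hτh]
  have hle : ∀ r ∈ Ioc τ (τ + h), ‖k r‖ₑ ≤ ENNReal.ofReal c₁ +
      (toMeasurable volume S).indicator (fun _ => ENNReal.ofReal c₂) r := by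
    intro r hr
    have hr' : r ∈ Icc τ (τ + h) := Ioc_subset_Icc_self hr
    rw [← ofReal_norm]
    by_cases hS : r ∈ S
    · rw [indicator_of_mem (subset_toMeasurable volume S hS)]
      exact (ENNReal.ofReal_le_ofReal (hbad r hr')).trans le_add_self
    · exact (ENNReal.ofReal_le_ofReal (hgood r hr' hS)).trans le_self_add
  calc ‖∫ r in Ioc τ (τ + h), k r‖ₑ ≤ ∫⁻ r in Ioc τ (τ + h), ‖k r‖ₑ :=
        enorm_integral_le_lintegral_enorm _
    _ ≤ ∫⁻ r in Ioc τ (τ + h), (ENNReal.ofReal c₁ +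
          (toMeasurable volume S).indicator (fun _ => ENNReal.ofReal c₂) r) :=
        setLIntegral_mono' measurableSet_Ioc hle
    _ = ENNReal.ofReal c₁ * ENNReal.ofReal h + ∫⁻ r in Ioc τ (τ + h),
          (toMeasurable volume S).indicator (fun _ => ENNReal.ofReal c₂) r := by
        rw [lintegral_add_left measurable_const, setLIntegral_const, Real.volume_Ioc,
          add_sub_cancel_left]
    _ ≤ ENNReal.ofReal c₁ * ENNReal.ofReal h + ∫⁻ r,
          (toMeasurable volume S).indicator (fun _ => ENNReal.ofReal c₂) r := by
        exact add_le_add_right (setLIntegral_le_lintegral _ _) _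
    _ = _ := by
        rw [lintegral_indicator_const (measurableSet_toMeasurable _ _), measure_toMeasurable]

/-- Each time contributes Γ·K·R times a variation: R = 3ε + δ and variation 2ε at good times, R = 2M
and variation M at bad ones. -/
theorem eventually_setLIntegral_enorm_le {n : ℕ} {f : State n → State n} (hf : ContDiff ℝ 2 f)
    {M : ℝ≥0} {K : ℝ} (hK0 : 0 ≤ K) (hK : ∀ v w, ‖v‖ ≤ M → ‖w‖ ≤ M →
      ‖fderiv ℝ f v - fderiv ℝ f w‖ ≤ K * ‖v - w‖)
    {u W : ℝ → ℝ → State n} {τ : ℝ} {a b : EReal} {ε : ℝ≥0} {ξ : ℝ}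
    (hu : IsWeakSolution f (Ioi 0 ×ˢ univ) u) (huL : LipschitzInL1 u)
    (huM : ∀ t, 0 ≤ t → eVariationOn (u t) univ ≤ M) (hτ : 0 ≤ τ)
    (hvar : eVariationOn (u τ) {x : ℝ | a < (x : EReal) ∧ (x : EReal) < b} ≤ ε)
    (ha : a < (ξ : EReal)) (hb : (ξ : EReal) < b)
    (hW : IsWeakCauchySolution (fun w => fderiv ℝ f (u τ ξ) w) τ (u τ) W)
    {l : State n →L[ℝ] ℝ} {Γ lam : ℝ} (hlΓ : ‖l‖ ≤ Γ) (hlam : |lam| ≤ 1)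
    (hl : l.comp (fderiv ℝ f (u τ ξ)) = lam • l) :
    ∀ᶠ h in 𝓝[>] (0 : ℝ), ∫⁻ x in shrink a b h, ‖l (u (τ + h) x - W (τ + h) x)‖ₑ ≤
      ENNReal.ofReal (8 * Γ * K * ε ^ 2) * ENNReal.ofReal h +
        ENNReal.ofReal (2 * Γ * K * M ^ 2) *
          volume {t ∈ Icc τ (τ + h) | 2 * (ε : ℝ≥0∞) < V u τ a b t} := by
  have hΓ : 0 ≤ Γ := (norm_nonneg _).trans hlΓ
  have hfd : Differentiable ℝ f := hf.differentiable (by norm_num)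
  have hbd : ∀ t, 0 ≤ t → ∀ x, ‖u t x‖ ≤ M := fun t ht x =>
    norm_le_of_integrable_of_eVariationOn_le (huL.1 t ht) (huM t ht) x
  have h₀ : ‖u τ ξ‖ ≤ M := hbd τ hτ ξ
  have hdist : ∀ v, ‖v‖ ≤ M → ‖v - u τ ξ‖ ≤ 2 * M := fun v hv =>
    (norm_sub_le _ _).trans (by linarith)
  have huc : ContinuousInL1 τ u := huL.continuousInL1.mono hτ
  set g := fluxRemainder f (u τ ξ) with hg
  have hgL : ∀ v w, ‖v‖ ≤ M → ‖w‖ ≤ M → ‖g v - g w‖ ≤ K * (2 * M) * ‖v - w‖ := fun v w hv hw =>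
    norm_fluxRemainder_sub_le hfd hK0 hK h₀ hv hw (hdist v hv) (hdist w hw)
  have hg0 : g 0 = 0 := by simp [hg, fluxRemainder]
  have hgc : Continuous g :=
    (hf.continuous.sub continuous_const).sub (fderiv ℝ f (u τ ξ)).continuous
  have hgu : ContinuousInL1 τ fun t x => g (u t x) := by
    refine huc.of_norm_sub_le (fun t ht => ?_) (K := K * (2 * M)) fun s t hs ht x =>
      hgL _ _ (hbd s (hτ.trans hs) x) (hbd t (hτ.trans ht) x)
    have h0t := hτ.trans ht
    refine ((huL.1 t h0t).norm.const_mul (K * (2 * M))).mono'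
      (hgc.comp_aestronglyMeasurable (huL.1 t h0t).aestronglyMeasurable)
      (Eventually.of_forall fun x => ?_)
    have h1 := hgL (u t x) 0 (hbd t h0t x) (by simp)
    rwa [hg0, sub_zero, sub_zero] at h1
  have hqc : ContinuousInL1 τ fun t x => l (g (u t x)) := hgu.clm_comp l
  -- Take δ = ε; if ε = 0 any δ > 0 serves, because the factor 2ε vanishes.
  obtain ⟨δ, hδ, hδε⟩ : ∃ δ : ℝ, 0 < δ ∧ (3 * ε + δ) * (2 * ε) = 8 * (ε : ℝ) ^ 2 := by
    rcases eq_or_ne ε 0 with rfl | hε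
    · exact ⟨1, one_pos, by simp⟩
    · exact ⟨ε, by positivity, by ring⟩
  obtain ⟨η, hη, hclose⟩ := eventually_norm_sub_le huL hτ hvar ha hb hδ
  filter_upwards [Ioc_mem_nhdsGT hη] with h hh
  have hh0 : 0 ≤ h := hh.1.le
  set S := {t ∈ Icc τ (τ + h) | 2 * (ε : ℝ≥0∞) < V u τ a b t} with hS
  have hSfin : volume S ≠ ∞ :=
    ((measure_mono fun x hx => hx.1).trans_lt (measure_Icc_lt_top (a := τ) (b := τ + h))).ne
  have hrhs : ENNReal.ofReal (8 * Γ * K * ε ^ 2) * ENNReal.ofReal h +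
      ENNReal.ofReal (2 * Γ * K * M ^ 2) * volume S ≠ ∞ := by finiteness
  rw [← ENNReal.ofReal_toReal hrhs]
  have hτh : τ ≤ τ + h := by linarith
  refine setLIntegral_enorm_le_of_forall_test (isOpen_shrink a b h)
    (l.integrable_comp ((huc.integrable _ hτh).sub (hW.integrable _ hτh)))
    fun ψ hψ hψc hψs hψ1 => ?_
  simp only [Pi.sub_apply]
  rw [integral_mul_sub_eq (hu.mono (prod_mono (Ioi_subset_Ioi hτ) le_rfl)) huc hW hl hqc hψ hψc hh0,
    ← Real.norm_eq_abs, ← toReal_enorm]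
  refine ENNReal.toReal_mono hrhs ?_
  have hkey : ∀ r ∈ Icc τ (τ + h), ∀ B, 0 ≤ B →
      eVariationOn (fun x => l (g (u r x))) (shrink a b (r - τ)) ≤ ENNReal.ofReal B →
      |∫ x, deriv (fun y => ψ (y + lam * (τ + h))) (x - lam * r) * l (g (u r x))| ≤ B := by
    intro r hr B hB0 hB
    have hd : ∀ x, deriv (fun y => ψ (y + lam * (τ + h))) (x - lam * r) =
        deriv ψ (x + lam * (τ + h - r)) := fun x => by
      rw [deriv_comp_add_const]
      congr 1
      ring
    simp only [hd]
    refine abs_integral_deriv_shift_mul_le hB0 (hqc.integrable r hr.1) ?_ hB hψ hψc hψs hψ1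
    -- Since |lam| ≤ 1, the shift over the remaining time τ + h − r is at most h − (r − τ).
    rw [abs_mul, abs_of_nonneg (by linarith [hr.2] : 0 ≤ τ + h - r)]
    nlinarith [hr.2]
  refine enorm_integral_le_of_bad_set hh0 (fun r hr hrS => ?_) fun r hr => ?_
  · have h0r : 0 ≤ r := hτ.trans hr.1
    have hV : V u τ a b r ≤ 2 * (ε : ℝ≥0∞) := by
      by_contra! h1
      exact hrS ⟨hr, h1⟩
    refine hkey r hr _ (by positivity) ?_
    have h2 : eVariationOn (u r) (shrink a b (r - τ)) ≤ ENNReal.ofReal (2 * ε) := by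
      rw [ENNReal.ofReal_mul zero_le_two, ENNReal.ofReal_coe_nnreal]
      simpa [V] using hV
    refine (eVariationOn_fluxRemainder_le hfd hK0 (by positivity) hK h₀ (hbd r h0r)
      (hclose r hr.1 (by linarith [hr.2, hh.2]) hV) h2 l hlΓ).trans_eq ?_
    congr 1
    linear_combination Γ * K * hδε
  · have h0r : 0 ≤ r := hτ.trans hr.1
    refine hkey r hr _ (by positivity) ?_
    have h2 : eVariationOn (u r) (shrink a b (r - τ)) ≤ ENNReal.ofReal M := by
      rw [ENNReal.ofReal_coe_nnreal]
      exact (eVariationOn.mono _ (subset_univ _)).trans (huM r h0r)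
    refine (eVariationOn_fluxRemainder_le hfd hK0 (by positivity) hK h₀ (hbd r h0r)
      (fun x _ => hdist _ (hbd r h0r x)) h2 l hlΓ).trans_eq ?_
    congr 1
    ring

/-! ### ### Summation over the spectral components and conclusion -/

theorem enorm_le_sum_coord {n : ℕ} (v : State n) : ‖v‖ₑ ≤ ∑ k, ‖v k‖ₑ := by
  have h1 : ‖v‖ ≤ ∑ k, ‖v k‖ := by
    calc ‖v‖ = ‖∑ k, v k • EuclideanSpace.basisFun (Fin n) ℝ k‖ := by
          congr 1
          exact ((EuclideanSpace.basisFun (Fin n) ℝ).sum_repr v).symm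
      _ ≤ ∑ k, ‖v k • EuclideanSpace.basisFun (Fin n) ℝ k‖ := norm_sum_le _ _
      _ = ∑ k, ‖v k‖ := by simp [norm_smul]
  simp only [← ofReal_norm]
  rw [← ENNReal.ofReal_sum_of_nonneg fun k _ => norm_nonneg _]
  exact ENNReal.ofReal_le_ofReal h1

theorem lintegral_enorm_le_sum {n : ℕ} {P : Fin n → State n →L[ℝ] State n}
    (hP : ∑ i, P i = ContinuousLinearMap.id ℝ (State n)) {μ : Measure ℝ} {v : ℝ → State n}
    (hv : AEStronglyMeasurable v μ) :
    ∫⁻ x, ‖v x‖ₑ ∂μ ≤ ∑ i, ∑ k, ∫⁻ x, ‖((EuclideanSpace.proj k).comp (P i)) (v x)‖ₑ ∂μ := by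
  have hm : ∀ i k, AEMeasurable (fun x => ‖((EuclideanSpace.proj k).comp (P i)) (v x)‖ₑ) μ :=
    fun i k => (((EuclideanSpace.proj k).comp (P i)).continuous.comp_aestronglyMeasurable hv).enorm
  have h1 : ∀ x, ‖v x‖ₑ ≤ ∑ i, ∑ k, ‖((EuclideanSpace.proj k).comp (P i)) (v x)‖ₑ := by
    intro x
    have h2 : v x = ∑ i, P i (v x) := by
      rw [← sum_apply, hP, ContinuousLinearMap.id_apply]
    calc ‖v x‖ₑ = ‖∑ i, P i (v x)‖ₑ := by rw [← h2]
      _ ≤ ∑ i, ‖P i (v x)‖ₑ := enorm_sum_le _ _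
      _ ≤ _ := Finset.sum_le_sum fun i _ => enorm_le_sum_coord _
  refine (lintegral_mono h1).trans_eq ?_
  rw [lintegral_finsetSum' _ fun i _ => Finset.aemeasurable_fun_sum _ fun k _ => hm i k]
  exact Finset.sum_congr rfl fun i _ => lintegral_finsetSum' _ fun k _ => hm i k

theorem norm_proj_comp_le {n : ℕ} (P : State n →L[ℝ] State n) (k : Fin n) {Γ : ℝ} (h : ‖P‖ ≤ Γ) :
    ‖(EuclideanSpace.proj k : State n →L[ℝ] ℝ).comp P‖ ≤ Γ := by
  refine ContinuousLinearMap.opNorm_le_bound _ ((norm_nonneg _).trans h) fun v => ?_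
  exact (PiLp.norm_apply_le (P v) k).trans (P.le_of_opNorm_le h v)

end ConservationLaw

theorem mainTheorem2 {n : ℕ} (f : ConservationLaw.State n → ConservationLaw.State n)
    (hf : ContDiff ℝ 2 f) (hyp : ConservationLaw.StrictlyHyperbolic f) (M : ℝ≥0) :
    ∃ C : ℝ≥0, ∀ (u : ℝ → ℝ → ConservationLaw.State n) (τ : ℝ) (a b : EReal) (ε : ℝ≥0) (ξ : ℝ)
      (W : ℝ → ℝ → ConservationLaw.State n),
      -- `u` is a weak solution, Lipschitz continuous with values in `L¹`
      ConservationLaw.IsWeakSolution f (Ioi 0 ×ˢ univ) u →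
      ConservationLaw.LipschitzInL1 u →
      -- all characteristic speeds along `u` are contained in `[-1, 1]`
      (∀ t x, 0 ≤ t → ConservationLaw.SpeedsInUnit f (u t x)) →
      -- uniformly bounded total variation
      (∀ t, 0 ≤ t → eVariationOn (u t) univ ≤ M) →
      0 ≤ τ →
      -- total variation at most `ε` on `]a, b[` at time `τ`
      eVariationOn (u τ) {x : ℝ | a < (x : EReal) ∧ (x : EReal) < b} ≤ ε →
      -- the set of times where `V(t) > 2ε` has density zero at `τ`, from the right
      Tendsto (fun h : ℝ =>
          volume {t ∈ Icc τ (τ + h) | 2 * (ε : ℝ≥0∞) < ConservationLaw.V u τ a b t}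
            / ENNReal.ofReal h)
        (𝓝[>] 0) (𝓝 0) →
      -- `W` solves the linear problem with constant coefficients `Df(u(τ,ξ))`, `ξ ∈ ]a, b[`
      a < (ξ : EReal) → (ξ : EReal) < b →
      ConservationLaw.IsWeakCauchySolution (fun w => fderiv ℝ f (u τ ξ) w) τ (u τ) W →
      limsup (fun h : ℝ =>
          (∫⁻ x in ConservationLaw.shrink a b h, ‖u (τ + h) x - W (τ + h) x‖ₑ)
            / ENNReal.ofReal h)
        (𝓝[>] 0) ≤ C * (ε : ℝ≥0∞) ^ 2 := by
  obtain ⟨Γ₀, hΓ₀⟩ := ConservationLaw.exists_spectral_bound hf hyp M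
  obtain ⟨K, hK0, hK⟩ := ConservationLaw.exists_lipschitz_fderiv hf M
  let Γ : ℝ≥0 := Γ₀.toNNReal
  let D : ℝ≥0 := 8 * Γ * K.toNNReal
  -- One factor n counts the projections, the other the coordinates of each.
  refine ⟨n * (n * D), ?_⟩
  intro u τ a b ε ξ W hu huL hspeed huM hτ hvar hdens ha hb hW
  obtain ⟨lam, P, hev, hPA, hPs, hPΓ⟩ := hΓ₀ (u τ ξ)
    (ConservationLaw.norm_le_of_integrable_of_eVariationOn_le (huL.1 τ hτ) (huM τ hτ) ξ)
  have hcomp : ∀ i k, ∀ᶠ h in 𝓝[>] (0 : ℝ),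
      ∫⁻ x in ConservationLaw.shrink a b h,
        ‖((EuclideanSpace.proj k).comp (P i) : ConservationLaw.State n →L[ℝ] ℝ)
          (u (τ + h) x - W (τ + h) x)‖ₑ ≤
      ENNReal.ofReal (8 * Γ * K * ε ^ 2) * ENNReal.ofReal h +
        ENNReal.ofReal (2 * Γ * K * M ^ 2) *
          volume {t ∈ Icc τ (τ + h) | 2 * (ε : ℝ≥0∞) < ConservationLaw.V u τ a b t} := by
    intro i k
    refine ConservationLaw.eventually_setLIntegral_enorm_le hf hK0 hK hu huL huM hτ hvar ha hb hW
      (ConservationLaw.norm_proj_comp_le (P i) k ((hPΓ i).trans (Real.le_coe_toNNReal _)))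
      (abs_le.2 (hspeed τ ξ hτ _ (hev i))) ?_
    rw [ContinuousLinearMap.comp_assoc, hPA i, ContinuousLinearMap.comp_smul]
  let bad : ℝ → ℝ≥0∞ := fun h =>
    volume {t ∈ Icc τ (τ + h) | 2 * (ε : ℝ≥0∞) < ConservationLaw.V u τ a b t}
  let c : ℝ≥0∞ := ENNReal.ofReal (2 * Γ * K * M ^ 2)
  have hD : ENNReal.ofReal (8 * Γ * K * ε ^ 2) = (D * ε ^ 2 : ℝ≥0) := by
    rw [← ENNReal.ofReal_coe_nnreal]
    congr 1
    simp [D, hK0]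
  have hbound : ∀ᶠ h in 𝓝[>] (0 : ℝ),
      (∫⁻ x in ConservationLaw.shrink a b h, ‖u (τ + h) x - W (τ + h) x‖ₑ) / ENNReal.ofReal h ≤
        n * (n * ((D * ε ^ 2 : ℝ≥0) + c * (bad h / ENNReal.ofReal h))) := by
    filter_upwards [eventually_all.2 fun i => eventually_all.2 fun k => hcomp i k,
      self_mem_nhdsWithin] with h hh h0
    have hτh : τ ≤ τ + h := by linarith [mem_Ioi.1 h0]
    have h1 : AEStronglyMeasurable (fun x => u (τ + h) x - W (τ + h) x)
        (volume.restrict (ConservationLaw.shrink a b h)) :=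
      ((huL.1 _ (hτ.trans hτh)).sub (hW.integrable _ hτh)).aestronglyMeasurable.restrict
    have h2 := (ConservationLaw.lintegral_enorm_le_sum hPs h1).trans
      (Finset.sum_le_sum fun i _ => Finset.sum_le_sum fun k _ => hh i k)
    have h3 : ENNReal.ofReal h ≠ 0 := by simpa using h0
    rw [ENNReal.div_le_iff h3 ENNReal.ofReal_ne_top]
    refine h2.trans_eq ?_
    simp only [Finset.sum_const, Finset.card_univ, Fintype.card_fin, nsmul_eq_mul]
    rw [hD, mul_assoc (n : ℝ≥0∞), mul_assoc (n : ℝ≥0∞), add_mul, mul_assoc c,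
      ENNReal.div_mul_cancel h3 ENNReal.ofReal_ne_top]
  -- The bad times drop out in the limit, since their density at τ is zero and c is finite.
  have hlim : Tendsto (fun h => (n : ℝ≥0∞) * (n * ((D * ε ^ 2 : ℝ≥0) +
      c * (bad h / ENNReal.ofReal h)))) (𝓝[>] 0) (𝓝 (n * (n * ((D * ε ^ 2 : ℝ≥0) + c * 0)))) := by
    have h1 : Tendsto (fun h => c * (bad h / ENNReal.ofReal h)) (𝓝[>] 0) (𝓝 (c * 0)) :=
      ENNReal.Tendsto.const_mul hdens (Or.inr ENNReal.ofReal_ne_top)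
    exact ENNReal.Tendsto.const_mul (ENNReal.Tendsto.const_mul (h1.const_add _)
      (Or.inr (ENNReal.natCast_ne_top n))) (Or.inr (ENNReal.natCast_ne_top n))
  refine (limsup_le_limsup hbound).trans ?_
  rw [hlim.limsup_eq]
  apply le_of_eq
  push_cast
  ring
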